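/- Let $n\ge 2$ and $m>2$ be integers and let $q\in\mathbb C$ be a primitive $m$th root of unity. Put $m'=m$ if $m$ is odd and $m'=m/2$ if $m$ is even. Let $\beta,\mu_1,\dots,\mu_{n-1},\nu_1,\dots,\nu_{n-1}$ be the simple roots of $A_{2n-1}$, let $P$ be the weight lattice, freely generated by the corresponding fundamental weights, and let $(\cdot\,|\,\cdot)$ be the pairing between $P$ and the root lattice for which fundamental weights and simple roots are dual bases. For $1\le i,j\le n$ put $\alpha_{i,j}=\mu_1+\dots+\mu_{i-1}+\beta+\nu_1+\dots+\nu_{j-1}$. Let $B$ be the semidirect product of the standard quantized matrix algebra $M_q(n)$ with the Laurent polynomial algebra $\mathbb C[L_1^{\pm1},\dots,L_{2n-1}^{\pm1}]$. That is, $B$ is the unital associative $\mathbb C$-algebra with generators $Z_{i,j}$ $(1\le i,j\le n)$ and $L_\xi$ $(\xi\in P)$ and relations $$Z_{i,j}Z_{i,k}=qZ_{i,k}Z_{i,j}\ (j<k),\qquad Z_{i,j}Z_{k,j}=qZ_{k,j}Z_{i,j}\ (i<k),\qquad Z_{i,j}Z_{s,t}=Z_{s,t}Z_{i,j}\ (i<s,\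 t<j),$$ $$Z_{i,j}Z_{s,t}=Z_{s,t}Z_{i,j}+(q-q^{-1})Z_{i,t}Z_{s,j}\ (i<s,\ j<t),$$ $$L_0=1,\qquad L_\xi L_\eta=L_{\xi+\eta},\qquad L_\xi Z_{i,j}=q^{(\xi|\alpha_{i,j})}Z_{i,j}L_\xi .$$ Let $\wp=(\zeta_1,\dots,\zeta_n,\xi_1,\dots,\xi_n)\in P^{2n}$, put $\tilde Z_{i,j}=Z_{i,j}L_{\zeta_i}L_{\xi_j}$, and let the modified algebra $M_q^\wp(n)$ be the subalgebra of $B$ generated by all $\tilde Z_{i,j}$. Assume that $$\tilde Z_{i,n+1-i}\,\tilde Z_{j,n+1-j}=\tilde Z_{j,n+1-j}\,\tilde Z_{i,n+1-i}\qquad\text{for all } i,j.$$ For $\Lambda=(\lambda_1,\dots,\lambda_n)\in\mathbb C^n$ let $I(\Lambda)$ be the left ideal of $M_q^\wp(n)$ generated by the elements $\tilde Z_{i,j}$ with $i+j\ge n+2$, the elements $\tilde Z_{k,n+1-k}-\lambda_k$ with $1\le k\le n$, and the elements $\tilde Z_{i,j}^{m'}$ with $i+j\le n$. Then the restricted Verma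 module $\overline{M_\wp(\Lambda)}=M_q^\wp(n)/I(\Lambda)$ is an irreducible left $M_q^\wp(n)$-module if and only if $\lambda_i\ne0$ for all $i=1,\dots,n$. -/

import Mathlib

/-- The simple roots of `A_{2n-1}`: the noncompact root `β = inl ()`, the compact roots
`μ_1, …, μ_{n-1}` (`inr (inl a)`, `a = 0, …, n-2`) and `ν_1, …, ν_{n-1}` (`inr (inr b)`). -/
abbrev SimpleRoot (n : ℕ) : Type := Unit ⊕ (Fin (n - 1) ⊕ Fin (n - 1))

/-- The weight lattice `P`, in coordinates with respect to the fundamental weights. -/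
abbrev WeightLattice (n : ℕ) : Type := SimpleRoot n → ℤ

/-- The root lattice `Q`, in coordinates with respect to the simple roots. -/
abbrev RootLattice (n : ℕ) : Type := SimpleRoot n → ℤ

/-- The pairing `P × Q → ℤ` with `(λ_i | α_j) = δ_{ij}` (all `d_j = 1` in type `A`). -/
def weightPairing {n : ℕ} (ξ : WeightLattice n) (α : RootLattice n) : ℤ :=
  ∑ k, ξ k * α k

/-- The root `α_{i,j} = μ_1 + ⋯ + μ_{i-1} + β + ν_1 + ⋯ + ν_{j-1}` of `Z_{i,j}`. Indices in
`Fin n` start at `0`, so the one-based index `i` is the element of `Fin n` with value `i - 1`. -/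
def rootZ {n : ℕ} (i j : Fin n) : RootLattice n
  | Sum.inl _ => 1
  | Sum.inr (Sum.inl a) => if (a : ℕ) < (i : ℕ) then 1 else 0
  | Sum.inr (Sum.inr b) => if (b : ℕ) < (j : ℕ) then 1 else 0

/-- Generators of the semidirect product `ℂ[L_1^{±1}, …, L_{2n-1}^{±1}] ×_s M_q(n)`:
the `Z_{i,j}` and the torus elements `L_ξ`, `ξ ∈ P`. -/
inductive TorusMatrixGen (n : ℕ) : Type
  | Z (i j : Fin n) : TorusMatrixGen n
  | L (ξ : WeightLattice n) : TorusMatrixGen n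

/-- The free generator `Z_{i,j}`. -/
noncomputable def freeZ {n : ℕ} (i j : Fin n) : FreeAlgebra ℂ (TorusMatrixGen n) :=
  FreeAlgebra.ι ℂ (TorusMatrixGen.Z i j)

/-- The free generator `L_ξ`. -/
noncomputable def freeL {n : ℕ} (ξ : WeightLattice n) : FreeAlgebra ℂ (TorusMatrixGen n) :=
  FreeAlgebra.ι ℂ (TorusMatrixGen.L ξ)

/-- Defining relations: those of the standard quantized matrix algebra `M_q(n)`, those of the
group algebra of `P` (the Laurent polynomials in the `L_k`), and the cross relations
`L_ξ Z_{i,j} = q^{(ξ | α_{i,j})} Z_{i,j} L_ξ`. -/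
inductive TorusMatrixRel (n : ℕ) (q : ℂ) :
    FreeAlgebra ℂ (TorusMatrixGen n) → FreeAlgebra ℂ (TorusMatrixGen n) → Prop
  | row (i j k : Fin n) (hjk : j < k) :
      TorusMatrixRel n q (freeZ i j * freeZ i k) (q • (freeZ i k * freeZ i j))
  | col (i j k : Fin n) (hik : i < k) :
      TorusMatrixRel n q (freeZ i j * freeZ k j) (q • (freeZ k j * freeZ i j))
  | anti (i j s t : Fin n) (his : i < s) (htj : t < j) :
      TorusMatrixRel n q (freeZ i j * freeZ s t) (freeZ s t * freeZ i j)
  | diag (i j s t : Fin n) (his : i < s) (hjt : j < t) :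
      TorusMatrixRel n q (freeZ i j * freeZ s t)
        (freeZ s t * freeZ i j + (q - q⁻¹) • (freeZ i t * freeZ s j))
  | torusOne : TorusMatrixRel n q (freeL 0) 1
  | torusMul (ξ η : WeightLattice n) :
      TorusMatrixRel n q (freeL ξ * freeL η) (freeL (ξ + η))
  | cross (ξ : WeightLattice n) (i j : Fin n) :
      TorusMatrixRel n q (freeL ξ * freeZ i j)
        (q ^ weightPairing ξ (rootZ i j) • (freeZ i j * freeL ξ))

/-- The algebra `ℂ[L_1^{±1}, …, L_{2n-1}^{±1}] ×_s M_q(n)`. -/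
def TorusMatrixAlgebra (n : ℕ) (q : ℂ) : Type := RingQuot (TorusMatrixRel n q)

noncomputable instance instRingTorusMatrixAlgebra (n : ℕ) (q : ℂ) :
    Ring (TorusMatrixAlgebra n q) :=
  inferInstanceAs (Ring (RingQuot (TorusMatrixRel n q)))

noncomputable instance instAlgebraTorusMatrixAlgebra (n : ℕ) (q : ℂ) :
    Algebra ℂ (TorusMatrixAlgebra n q) :=
  inferInstanceAs (Algebra ℂ (RingQuot (TorusMatrixRel n q)))

/-- The quotient map from the free algebra. -/
noncomputable def toTorusMatrixAlgebra (n : ℕ) (q : ℂ) :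
    FreeAlgebra ℂ (TorusMatrixGen n) →ₐ[ℂ] TorusMatrixAlgebra n q :=
  RingQuot.mkAlgHom ℂ (TorusMatrixRel n q)

theorem toTorusMatrixAlgebra_rel {n : ℕ} {q : ℂ} {x y : FreeAlgebra ℂ (TorusMatrixGen n)}
    (h : TorusMatrixRel n q x y) : toTorusMatrixAlgebra n q x = toTorusMatrixAlgebra n q y :=
  RingQuot.mkAlgHom_rel ℂ h

/-- The element `Z_{i,j}`. -/
noncomputable def matZ (n : ℕ) (q : ℂ) (i j : Fin n) : TorusMatrixAlgebra n q :=
  toTorusMatrixAlgebra n q (freeZ i j)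

/-- The element `L_ξ`. -/
noncomputable def torusL (n : ℕ) (q : ℂ) (ξ : WeightLattice n) : TorusMatrixAlgebra n q :=
  toTorusMatrixAlgebra n q (freeL ξ)

/-- The datum `℘ = (ζ_1, …, ζ_n, ξ_1, …, ξ_n) ∈ P^{2n}`. -/
structure ModificationDatum (n : ℕ) : Type where
  ζ : Fin n → WeightLattice n
  ξ : Fin n → WeightLattice n

/-- The modified generator `Z̃_{i,j} = Z_{i,j} L_{ζ_i} L_{ξ_j}`. -/
noncomputable def modZ {n : ℕ} (q : ℂ) (w : ModificationDatum n) (i j : Fin n) :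
    TorusMatrixAlgebra n q :=
  matZ n q i j * torusL n q (w.ζ i) * torusL n q (w.ξ j)

/-- The modified algebra `M_q^℘(n)`: the subalgebra generated by all `Z̃_{i,j}`. -/
noncomputable def modifiedAlgebra {n : ℕ} (q : ℂ) (w : ModificationDatum n) :
    Subalgebra ℂ (TorusMatrixAlgebra n q) :=
  Algebra.adjoin ℂ {x | ∃ i j : Fin n, x = modZ q w i j}

/-- `Z̃_{i,j}` as an element of `M_q^℘(n)`. -/
noncomputable def modGen {n : ℕ} (q : ℂ) (w : ModificationDatum n) (i j : Fin n) :
    modifiedAlgebra q w :=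
  ⟨modZ q w i j, Algebra.subset_adjoin ⟨i, j, rfl⟩⟩

/-- The elements `Z̃_{i,n+1-i}` on the antidiagonal commute with each other. In one-based
indices `Fin.rev i` is `n + 1 - i`. -/
def AntidiagonalCommutes {n : ℕ} (q : ℂ) (w : ModificationDatum n) : Prop :=
  ∀ i j : Fin n, modGen q w i i.rev * modGen q w j j.rev =
    modGen q w j j.rev * modGen q w i i.rev

/-- `m' = m` for `m` odd and `m' = m / 2` for `m` even. -/
def reducedOrder (m : ℕ) : ℕ := if Even m then m / 2 else m

/-- The left ideal `I(Λ)` of `M_q^℘(n)` generated by the `Z̃_{i,j}` with `i + j ≥ n + 2`, the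
`Z̃_{k,n+1-k} - λ_k`, and the `Z̃_{i,j}^{m'}` with `i + j ≤ n` (one-based indices). -/
noncomputable def restrictedIdeal {n : ℕ} (m : ℕ) (q : ℂ) (w : ModificationDatum n)
    (Λ : Fin n → ℂ) : Submodule (modifiedAlgebra q w) (modifiedAlgebra q w) :=
  Submodule.span (modifiedAlgebra q w)
    ({x | ∃ i j : Fin n, n + 2 ≤ ((i : ℕ) + 1) + ((j : ℕ) + 1) ∧ x = modGen q w i j} ∪
     {x | ∃ k : Fin n,
        x = modGen q w k k.rev - algebraMap ℂ (modifiedAlgebra q w) (Λ k)} ∪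
     {x | ∃ i j : Fin n, ((i : ℕ) + 1) + ((j : ℕ) + 1) ≤ n ∧
        x = modGen q w i j ^ reducedOrder m})

/-- The restricted Verma module: the left module `M_q^℘(n) / I(Λ)`. -/
abbrev RestrictedVerma {n : ℕ} (m : ℕ) (q : ℂ) (w : ModificationDatum n)
    (Λ : Fin n → ℂ) : Type :=
  modifiedAlgebra q w ⧸ restrictedIdeal m q w Λ

/-!
After the columns are reversed, the generators with `i + j ≤ n` lie above the diagonal and those
on the antidiagonal become the diagonal; up to scalars, two generators commute unless they are in
crossing position. Straightening monomials with these relations shows that the restricted Verma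
module has dimension at most `m' ^ (n (n - 1) / 2)`.

This bound is attained by a Fock model. A representation `Z` of the quantized matrix algebra of
size `n` gives one of size `n + 1` by the product `(1 ⊕ Z) G₀ ⋯ Gₙ₋₁`, where `Gⱼ` is a
`q`-oscillator truncated at `m'` levels, placed in the columns `j` and `j + 1`. The vacuum is
cyclic, and every vector annihilated by the entries below the antidiagonal is a multiple of it.
The torus and the twist by `℘` are absorbed by passing to functions on the weight lattice with
values in the Fock space, on which `L_ξ` acts by translation. The antidiagonal generators act on
scalar functions times the vacuum by weighted shifts. These preserve the finite-dimensional space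
of functions periodic modulo `m`, and commute by the assumption on `℘`, so they have a common
eigenfunction. Scaling rows and columns then realizes every `Λ`.

If no `λ_k` vanishes, the restricted Verma module embeds into this model by the dimension bound.
By an Engel-type argument a nonzero submodule contains a nonzero vector annihilated by the entries
below the antidiagonal; this is a function times the vacuum, so it generates a space of full
dimension.

If some `λ_k` vanishes, then `λ_a λ_{a+1} = 0` for some `a`, and the generator next to the
antidiagonal between rows `a` and `a + 1` sends the highest weight vector to a vector which is
nonzero in a degenerate scaling of the Fock model and again annihilated by the entries below the
antidiagonal. The submodule it generates is spanned by images of generators above the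
antidiagonal. It is therefore proper, as the same Engel argument on the dual space yields a
nonzero functional which vanishes on all these images.
-/

section SkewCommute

variable {K R S : Type*} [Field K] [Ring R] [Algebra K R] [Ring S] [Algebra K S]

/-- The elements `a` and `b` of a `K`-algebra commute up to a nonzero scalar. -/
def SkewCommute (K : Type*) {R : Type*} [Field K] [Ring R] [Algebra K R] (a b : R) : Prop :=
  ∃ c : K, c ≠ 0 ∧ a * b = c • (b * a)

namespace SkewCommute

variable {a b c : R}

theorem map (h : SkewCommute K a b) (f : R →ₐ[K] S) : SkewCommute K (f a) (f b) := by
  obtain ⟨c, hc0, hc⟩ := h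
  exact ⟨c, hc0, by rw [← map_mul, hc, map_smul, map_mul]⟩

theorem of_commute (h : Commute a b) : SkewCommute K a b :=
  ⟨1, one_ne_zero, by rw [one_smul, h.eq]⟩

theorem symm (h : SkewCommute K a b) : SkewCommute K b a := by
  obtain ⟨c, hc0, hc⟩ := h
  exact ⟨c⁻¹, inv_ne_zero hc0, by rw [hc, inv_smul_smul₀ hc0]⟩

theorem mul_right (hb : SkewCommute K a b) (hc : SkewCommute K a c) : SkewCommute K a (b * c) := by
  obtain ⟨x, hx0, hx⟩ := hb
  obtain ⟨y, hy0, hy⟩ := hc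
  exact ⟨x * y, mul_ne_zero hx0 hy0, by
    rw [← mul_assoc, hx, smul_mul_assoc, mul_assoc, hy, mul_smul_comm, smul_smul, mul_assoc]⟩

theorem mul_left (ha : SkewCommute K a c) (hb : SkewCommute K b c) : SkewCommute K (a * b) c :=
  (ha.symm.mul_right hb.symm).symm

theorem pow_right (h : SkewCommute K a b) (k : ℕ) : SkewCommute K a (b ^ k) := by
  induction k with
  | zero => exact pow_zero b ▸ of_commute (Commute.one_right a)
  | succ k ih => exact pow_succ b k ▸ ih.mul_right h

theorem pow_left (h : SkewCommute K a b) (k : ℕ) : SkewCommute K (a ^ k) b :=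
  (h.symm.pow_right k).symm

theorem smul_left (h : SkewCommute K a b) (r : K) : SkewCommute K (r • a) b := by
  obtain ⟨c, hc0, hc⟩ := h
  exact ⟨c, hc0, by rw [smul_mul_assoc, hc, mul_smul_comm, smul_comm]⟩

theorem exists_mul_pow (h : SkewCommute K a b) (k : ℕ) :
    ∃ c : K, (a * b) ^ k = c • (a ^ k * b ^ k) := by
  induction k with
  | zero => exact ⟨1, by simp⟩
  | succ k ih =>
    obtain ⟨c, hc⟩ := ih
    obtain ⟨d, -, hd⟩ := (h.pow_right k).symm
    exact ⟨c * d, by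
      rw [pow_succ, hc, smul_mul_assoc, mul_assoc, ← mul_assoc (b ^ k), hd, smul_mul_assoc,
        mul_smul_comm, smul_smul, mul_assoc a, ← pow_succ, ← mul_assoc, ← pow_succ]⟩

end SkewCommute

end SkewCommute

section StableClosure

variable {K M : Type*} [Field K] [AddCommGroup M] [Module K M]

theorem SkewCommute.exists_apply {f g : Module.End K M} (h : SkewCommute K f g) :
    ∃ c : K, ∀ u, f (g u) = c • g (f u) :=
  h.imp fun _ hc u => LinearMap.congr_fun hc.2 u

/-- The smallest subspace which contains `T` and is stable under all operators in `F`. -/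
def stableClosure (F : Set (Module.End K M)) (T : Submodule K M) : Submodule K M :=
  sInf {p | T ≤ p ∧ ∀ f ∈ F, ∀ u ∈ p, f u ∈ p}

/-- The sum of the images of `p` under the powers of `x` with exponent less than `e`. -/
def powSup (x : Module.End K M) (e : ℕ) (p : Submodule K M) : Submodule K M :=
  (Finset.range e).sup fun k => p.map (x ^ k)

variable {F : Set (Module.End K M)} {T p : Submodule K M}

theorem le_stableClosure : T ≤ stableClosure F T :=
  le_sInf fun _ hp => hp.1

theorem apply_mem_stableClosure {f : Module.End K M} (hf : f ∈ F) {u : M}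
    (hu : u ∈ stableClosure F T) : f u ∈ stableClosure F T := by
  simp only [stableClosure, Submodule.mem_sInf] at hu ⊢
  exact fun p hp => hp.2 f hf u (hu p hp)

theorem stableClosure_le (hT : T ≤ p) (hp : ∀ f ∈ F, ∀ u ∈ p, f u ∈ p) :
    stableClosure F T ≤ p :=
  sInf_le ⟨hT, hp⟩

theorem forall_apply_mem_of_mem_stableClosure {G : Set (Module.End K M)}
    (hT : ∀ u ∈ T, ∀ g ∈ G, g u ∈ p)
    (hF : ∀ f ∈ F, ∀ u ∈ stableClosure F T, (∀ g ∈ G, g u ∈ p) → ∀ g ∈ G, g (f u) ∈ p) :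
    ∀ u ∈ stableClosure F T, ∀ g ∈ G, g u ∈ p := by
  have hle : stableClosure F T ≤ stableClosure F T ⊓ ⨅ g ∈ G, p.comap g := by
    refine stableClosure_le (le_inf le_stableClosure fun u hu => ?_) fun f hf u hu => ?_
    · simpa [Submodule.mem_iInf] using hT u hu
    · simp only [Submodule.mem_inf, Submodule.mem_iInf, Submodule.mem_comap] at hu ⊢
      exact ⟨apply_mem_stableClosure hf hu.1, hF f hf u hu.1 hu.2⟩
  intro u hu
  simpa [Submodule.mem_iInf] using (hle hu).2

variable {x : Module.End K M} {e : ℕ}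

theorem map_pow_le_powSup (hx : x ^ e = 0) (k : ℕ) : p.map (x ^ k) ≤ powSup x e p := by
  rcases lt_or_ge k e with hk | hk
  · exact Finset.le_sup (f := fun k => p.map (x ^ k)) (Finset.mem_range.2 hk)
  · simp [pow_eq_zero_of_le hk hx]

theorem le_powSup (hx : x ^ e = 0) : p ≤ powSup x e p := by
  simpa [Module.End.one_eq_id] using map_pow_le_powSup (p := p) hx 0

theorem apply_mem_powSup (hx : x ^ e = 0) {u : M} (hu : u ∈ powSup x e p) :
    x u ∈ powSup x e p := by
  suffices h : powSup x e p ≤ (powSup x e p).comap x from h hu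
  refine Finset.sup_le fun k _ => ?_
  rintro _ ⟨v, hv, rfl⟩
  rw [Submodule.mem_comap, ← Module.End.mul_apply, ← pow_succ']
  exact map_pow_le_powSup hx (k + 1) (Submodule.mem_map_of_mem hv)

theorem SkewCommute.apply_mem_powSup {y : Module.End K M} (h : SkewCommute K y x)
    (hy : ∀ u ∈ p, y u ∈ p) {u : M} (hu : u ∈ powSup x e p) : y u ∈ powSup x e p := by
  suffices h : powSup x e p ≤ (powSup x e p).comap y from h hu
  refine Finset.sup_le fun k hk => ?_
  rintro _ ⟨v, hv, rfl⟩
  obtain ⟨c, hc⟩ := (h.pow_right k).exists_apply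
  rw [Submodule.mem_comap, hc]
  exact Submodule.smul_mem _ _
    ((Finset.le_sup (f := fun k => p.map (x ^ k)) hk :) (Submodule.mem_map_of_mem (hy v hv)))

instance [FiniteDimensional K p] : FiniteDimensional K (powSup x e p) :=
  Submodule.finiteDimensional_finset_sup _ _

theorem finrank_powSup_le [FiniteDimensional K p] :
    Module.finrank K (powSup x e p) ≤ e * Module.finrank K p := by
  induction e with
  | zero => rw [powSup, Finset.range_zero, Finset.sup_empty, finrank_bot, zero_mul]
  | succ e ih =>
    rw [powSup, Finset.range_add_one, Finset.sup_insert, add_mul, one_mul, add_comm]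
    exact (Submodule.finrank_add_le_finrank_add_finrank _ (powSup x e p)).trans
      (add_le_add (Submodule.finrank_map_le _ _) ih)

theorem stableClosure_insert_le (hx : x ^ e = 0) (hF : ∀ y ∈ F, SkewCommute K y x) :
    stableClosure (insert x F) T ≤ powSup x e (stableClosure F T) := by
  refine stableClosure_le (le_stableClosure.trans (le_powSup hx)) ?_
  rintro f (rfl | hf) u hu
  · exact apply_mem_powSup hx hu
  · exact (hF f hf).apply_mem_powSup (fun _ => apply_mem_stableClosure hf) hu

theorem finrank_stableClosure_le (F : Finset (Module.End K M))
    (hF : ∀ x ∈ F, ∀ y ∈ F, SkewCommute K x y) (hpow : ∀ x ∈ F, x ^ e = 0)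
    [FiniteDimensional K T] :
    FiniteDimensional K (stableClosure (F : Set (Module.End K M)) T) ∧
      Module.finrank K (stableClosure (F : Set (Module.End K M)) T) ≤
        e ^ F.card * Module.finrank K T := by
  classical
  induction F using Finset.induction_on with
  | empty =>
    have hle : stableClosure ((∅ : Finset (Module.End K M)) : Set (Module.End K M)) T ≤ T :=
      stableClosure_le le_rfl (by simp)
    exact ⟨Submodule.finiteDimensional_of_le hle, by simpa using Submodule.finrank_mono hle⟩
  | insert x F hxF ih =>
    simp only [Finset.forall_mem_insert] at hF hpow
    obtain ⟨_, hrank⟩ := ih (fun y hy => (hF.2 y hy).2) hpow.2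
    have hle := stableClosure_insert_le (F := F) (T := T) hpow.1 fun y hy => (hF.2 y hy).1
    rw [Finset.coe_insert, Finset.card_insert_of_notMem hxF, pow_succ', mul_assoc]
    exact ⟨Submodule.finiteDimensional_of_le hle, (Submodule.finrank_mono hle).trans
      (finrank_powSup_le.trans (Nat.mul_le_mul_left _ hrank))⟩

end StableClosure

section JointKernel

variable {K M : Type*} [Field K] [AddCommGroup M] [Module K M]

theorem exists_pow_apply_ne_zero_of_isNilpotent {x : Module.End K M} (hx : IsNilpotent x) {u : M}
    (hu : u ≠ 0) : ∃ k, (x ^ k) u ≠ 0 ∧ x ((x ^ k) u) = 0 := by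
  by_contra! h
  obtain ⟨N, hN⟩ := hx
  have hne : ∀ k, (x ^ k) u ≠ 0 := by
    intro k
    induction k with
    | zero => simpa using hu
    | succ k ih => simpa [pow_succ'] using h k ih
  exact hne N (by simp [hN])

-- An Engel-type argument: the kernel of the smaller operators is stable under the next one, so the
-- last nonzero power of the next operator on a common null vector is again a common null vector.
theorem exists_ne_zero_forall_apply_eq_zero {ι : Type*} [LinearOrder ι] {x : ι → Module.End K M}
    (s : Finset ι) (hx : ∀ a ∈ s, IsNilpotent (x a))
    (hker : ∀ b ∈ s, ∀ u, (∀ a ∈ s, a < b → x a u = 0) → ∀ a ∈ s, a < b → x a (x b u) = 0)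
    {U : Submodule K M} (hU : ∀ a ∈ s, ∀ u ∈ U, x a u ∈ U) (hne : U ≠ ⊥) :
    ∃ u ∈ U, u ≠ 0 ∧ ∀ a ∈ s, x a u = 0 := by
  induction s using Finset.induction_on_max with
  | empty =>
    obtain ⟨u, hu, hu0⟩ := U.exists_mem_ne_zero_of_ne_bot hne
    exact ⟨u, hu, hu0, by simp⟩
  | insert b s hb ih =>
    simp only [Finset.forall_mem_insert, lt_irrefl, IsEmpty.forall_iff, true_and] at *
    obtain ⟨u, hu, hu0, hsu⟩ := ih hx.2
      (fun c hc u h a ha hac => (hker.2 c hc u ⟨fun hbc => absurd hbc (hb c hc).asymm, h⟩).2 a ha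
        hac) hU.2
    obtain ⟨k, hk, hbk⟩ := exists_pow_apply_ne_zero_of_isNilpotent hx.1 hu0
    have hpow : ∀ l, (x b ^ l) u ∈ U ∧ ∀ a ∈ s, x a ((x b ^ l) u) = 0 := by
      intro l
      induction l with
      | zero => simpa using ⟨hu, hsu⟩
      | succ l ih =>
        rw [pow_succ', Module.End.mul_apply]
        exact ⟨hU.1 _ ih.1, fun a ha => hker.1 _ (fun a ha _ => ih.2 a ha) a ha (hb a ha)⟩
    exact ⟨_, (hpow k).1, hk, hbk, (hpow k).2⟩

end JointKernel

/-- Straightening relations, up to unspecified scalars, for a matrix of elements of a `K`-algebra: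
entries in crossing position commute up to a scalar and a correction term, all others commute up to
a scalar. -/
structure Straightening (K : Type*) {R : Type*} [Field K] [Ring R] [Algebra K R] {n : ℕ}
    (X : Fin n → Fin n → R) : Prop where
  skew : ∀ i j a b, ¬ (i < a ∧ b < j) → ¬ (a < i ∧ j < b) → SkewCommute K (X i j) (X a b)
  cross : ∀ i j a b, a < i → j < b →
    ∃ c d : K, X i j * X a b = c • (X a b * X i j) + d • (X a j * X i b)

theorem isNilpotent_dualMap {K M : Type*} [Field K] [AddCommGroup M] [Module K M]
    {f : Module.End K M} (hf : IsNilpotent f) :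
    IsNilpotent (LinearMap.dualMap f : Module.End K (Module.Dual K M)) := by
  obtain ⟨e, he⟩ := hf
  have hpow : ∀ e, (LinearMap.dualMap f : Module.End K (Module.Dual K M)) ^ e =
      LinearMap.dualMap (f ^ e) := by
    intro e
    induction e with
    | zero => rfl
    | succ e ih => rw [pow_succ', pow_succ, ih]; rfl
  exact ⟨e, by rw [hpow, he]; exact LinearMap.ext fun φ => φ.comp_zero⟩

namespace Straightening

section Algebra

variable {K R S : Type*} [Field K] [Ring R] [Algebra K R] [Ring S] [Algebra K S] {n : ℕ}
  {X : Fin n → Fin n → R}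

theorem map (h : Straightening K X) (f : R →ₐ[K] S) : Straightening K fun i j => f (X i j) where
  skew i j a b h1 h2 := (h.skew i j a b h1 h2).map f
  cross i j a b h1 h2 := by
    obtain ⟨c, d, hc⟩ := h.cross i j a b h1 h2
    exact ⟨c, d, by rw [← map_mul, hc, map_add, map_smul, map_smul, map_mul, map_mul]⟩

end Algebra

variable {K M : Type*} [Field K] [AddCommGroup M] [Module K M] {n : ℕ}
  {X : Fin n → Fin n → Module.End K M}

theorem exists_apply_cross (h : Straightening K X) {i j a b : Fin n} (h1 : a < i) (h2 : j < b) :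
    ∃ c d : K, ∀ u, X i j (X a b u) = c • X a b (X i j u) + d • X a j (X i b u) := by
  obtain ⟨c, d, hc⟩ := h.cross i j a b h1 h2
  exact ⟨c, d, fun u => LinearMap.congr_fun hc u⟩

theorem dualMap (h : Straightening K X) :
    Straightening K fun i j => (LinearMap.dualMap (X j i) : Module.End K (Module.Dual K M)) where
  skew i j a b h1 h2 := by
    obtain ⟨c, hc0, hc⟩ := h.skew b a j i (fun h => h1 h.symm) fun h => h2 h.symm
    exact ⟨c, hc0, LinearMap.ext fun φ => LinearMap.ext fun u => by
      simpa using congr_arg φ (LinearMap.congr_fun hc u)⟩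
  cross i j a b h1 h2 := by
    obtain ⟨c, d, hc⟩ := h.exists_apply_cross h2 h1
    obtain ⟨c', hc'⟩ := (h.skew j a b i (fun h => h1.asymm h.2) fun h => h2.asymm h.1).exists_apply
    exact ⟨c, d * c', LinearMap.ext fun φ => LinearMap.ext fun u => by simp [hc, hc', mul_assoc]⟩

theorem lower_apply_eq_zero_of_lex (h : Straightening K X) {i j : Fin n} (hji : j < i) {u : M}
    (hu : ∀ a b, b < a → i < a ∨ i = a ∧ b < j → X a b u = 0) {a b : Fin n} (hba : b < a)
    (hab : i < a ∨ i = a ∧ b < j) : X a b (X i j u) = 0 := by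
  rcases lt_or_ge b j with hbj | hbj
  · rcases hab with hia | ⟨rfl, -⟩
    · obtain ⟨c, d, hcd⟩ := h.exists_apply_cross hia hbj
      rw [hcd, hu a b hba (.inl hia), hu a j (hji.trans hia) (.inl hia)]
      simp
    · obtain ⟨c, hc⟩ := (h.skew i b i j (by simp) (by simp)).exists_apply
      rw [hc, hu i b hba (.inr ⟨rfl, hbj⟩), map_zero, smul_zero]
  · obtain hia : i < a := hab.resolve_right fun h => hbj.not_gt h.2
    obtain ⟨c, hc⟩ := (h.skew a b i j (by simp [hia.le]) (by simp [hbj])).exists_apply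
    rw [hc, hu a b hba (.inl hia), map_zero, smul_zero]

theorem exists_lower_apply_eq_zero (h : Straightening K X)
    (hnil : ∀ i j, j < i → IsNilpotent (X i j)) {U : Submodule K M}
    (hU : ∀ i j, j < i → ∀ u ∈ U, X i j u ∈ U) (hne : U ≠ ⊥) :
    ∃ u ∈ U, u ≠ 0 ∧ ∀ i j, j < i → X i j u = 0 := by
  let row (a : (Fin n)ᵒᵈ ×ₗ Fin n) : Fin n := OrderDual.ofDual (ofLex a).1
  let col (a : (Fin n)ᵒᵈ ×ₗ Fin n) : Fin n := (ofLex a).2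
  have hlt : ∀ a b, a < b ↔ row b < row a ∨ row b = row a ∧ col a < col b := fun a b => by
    rw [Prod.Lex.lt_iff]
    exact or_congr Iff.rfl (and_congr_left' eq_comm)
  obtain ⟨u, hu, hu0, hlow⟩ := exists_ne_zero_forall_apply_eq_zero
    (x := fun a => X (row a) (col a)) (Finset.univ.filter fun a => col a < row a)
    (by simpa using fun a => hnil (row a) (col a))
    (by
      simp only [Finset.mem_filter_univ, hlt]
      exact fun b hb u hu a ha hab => h.lower_apply_eq_zero_of_lex hb
        (fun i j hij hb => hu (toLex (OrderDual.toDual i, j)) hij hb) ha hab)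
    (by simpa using fun a => hU (row a) (col a)) hne
  exact ⟨u, hu, hu0, fun i j hij => hlow (toLex (OrderDual.toDual i, j))
    (Finset.mem_filter_univ _ |>.2 hij)⟩

theorem exists_dual_comp_upper_eq_zero [Nontrivial M] (h : Straightening K X)
    (hnil : ∀ i j, i < j → IsNilpotent (X i j)) :
    ∃ φ : Module.Dual K M, φ ≠ 0 ∧ ∀ i j, i < j → ∀ u, φ (X i j u) = 0 := by
  obtain ⟨φ, -, hφ, hupper⟩ := h.dualMap.exists_lower_apply_eq_zero (U := ⊤)
    (fun i j hji => isNilpotent_dualMap (hnil j i hji)) (by simp) top_ne_bot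
  exact ⟨φ, hφ, fun i j hij u => LinearMap.congr_fun (hupper j i hij) u⟩

/-- The closure of `T` under the entries of row `r` to the right of the diagonal. -/
def rowClosure (X : Fin n → Fin n → Module.End K M) (r : Fin n) (T : Submodule K M) :
    Submodule K M :=
  stableClosure {f | ∃ k, r < k ∧ f = X r k} T

/-- The subspace `T` behaves like the span of the ordered monomials in the upper entries of the
rows with index at least `r`, applied to a vector which is killed by the lower entries: it is killed
by the lower entries in the columns before `r`, and stable under the diagonal and under the block of
entries with both indices at least `r`. -/
structure BlockStable (X : Fin n → Fin n → Module.End K M) (r : ℕ) (T : Submodule K M) :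
    Prop where
  lower : ∀ i j : Fin n, j < i → (j : ℕ) < r → ∀ u ∈ T, X i j u = 0
  diag : ∀ i, ∀ u ∈ T, X i i u ∈ T
  block : ∀ i j : Fin n, r ≤ i → r ≤ j → ∀ u ∈ T, X i j u ∈ T

variable {r : Fin n} {T : Submodule K M}

theorem le_rowClosure : T ≤ rowClosure X r T :=
  le_stableClosure

theorem row_apply_mem_rowClosure {k : Fin n} (hk : r < k) {u : M} (hu : u ∈ rowClosure X r T) :
    X r k u ∈ rowClosure X r T :=
  apply_mem_stableClosure (F := {f | ∃ k, r < k ∧ f = X r k}) ⟨k, hk, rfl⟩ hu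

theorem BlockStable.lower_rowClosure (h : Straightening K X) (hT : BlockStable X (r + 1) T)
    {i j : Fin n} (hji : j < i) (hjr : j < r) {u : M} (hu : u ∈ rowClosure X r T) :
    X i j u = 0 := by
  refine forall_apply_mem_of_mem_stableClosure (p := ⊥)
    (G := {g | ∃ i j : Fin n, j < i ∧ j < r ∧ g = X i j}) ?_ ?_ u hu (X i j) ⟨i, j, hji, hjr, rfl⟩
  · rintro u hu _ ⟨i, j, hji, hjr, rfl⟩
    exact hT.lower i j hji (Nat.lt_succ_of_lt hjr) u hu
  · rintro _ ⟨k, hk, rfl⟩ u - hlow _ ⟨i, j, hji, hjr, rfl⟩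
    have hlow : ∀ i j, j < i → j < r → X i j u = 0 := fun i j hji hjr => by
      simpa using hlow (X i j) ⟨i, j, hji, hjr, rfl⟩
    rw [Submodule.mem_bot]
    by_cases hri : r < i
    · obtain ⟨c, d, hcd⟩ := h.exists_apply_cross hri (hjr.trans hk)
      obtain ⟨c', hc'⟩ := (h.skew r j i k (by simp [(hjr.trans hk).le])
        (by simp [hri.le])).exists_apply
      rw [hcd, hc', hlow i j hji hjr, hlow r j hjr hjr]
      simp
    · obtain ⟨c, hc⟩ := (h.skew i j r k (by simp [(hjr.trans hk).le])
        (by simp [not_lt.1 hri])).exists_apply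
      rw [hc, hlow i j hji hjr]
      simp

theorem BlockStable.diag_or_block_apply_mem_rowClosure (h : Straightening K X)
    (hT : BlockStable X (r + 1) T) {i j : Fin n} (hij : i = j ∨ r < i ∧ r < j) {u : M}
    (hu : u ∈ rowClosure X r T) : X i j u ∈ rowClosure X r T := by
  refine forall_apply_mem_of_mem_stableClosure
    (G := {g | ∃ i j : Fin n, (i = j ∨ r < i ∧ r < j) ∧ g = X i j}) ?_ ?_ u hu (X i j)
    ⟨i, j, hij, rfl⟩
  · rintro u hu _ ⟨i, j, rfl | ⟨hi, hj⟩, rfl⟩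
    · exact le_rowClosure (hT.diag i u hu)
    · exact le_rowClosure (hT.block i j hi hj u hu)
  · rintro _ ⟨k, hk, rfl⟩ u - hmem _ ⟨i, j, hij, rfl⟩
    have hmem : ∀ i j, (i = j ∨ r < i ∧ r < j) → X i j u ∈ rowClosure X r T := fun i j hij =>
      hmem _ ⟨i, j, hij, rfl⟩
    have hskew : ∀ c : K, c • X r k (X i j u) ∈ rowClosure X r T := fun c =>
      Submodule.smul_mem _ c (row_apply_mem_rowClosure hk (hmem i j hij))
    by_cases hc : r < i ∧ j < k
    · have hrj : r < j := hij.elim (fun h => h ▸ hc.1) fun h => h.2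
      obtain ⟨c, d, hcd⟩ := h.exists_apply_cross hc.1 hc.2
      rw [hcd]
      exact add_mem (hskew c) (Submodule.smul_mem _ _
        (row_apply_mem_rowClosure hrj (hmem i k (.inr ⟨hc.1, hk⟩))))
    · obtain ⟨c, hc⟩ := (h.skew i j r k
        (fun h' => by rcases hij with rfl | hij <;> order) hc).exists_apply
      rw [hc]
      exact hskew c

theorem BlockStable.col_apply_mem_rowClosure (h : Straightening K X)
    (hT : BlockStable X (r + 1) T) {i : Fin n} (hi : r < i) {u : M}
    (hu : u ∈ rowClosure X r T) : X i r u ∈ rowClosure X r T := by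
  refine forall_apply_mem_of_mem_stableClosure
    (G := {g | ∃ i : Fin n, r < i ∧ g = X i r}) ?_ ?_ u hu (X i r) ⟨i, hi, rfl⟩
  · rintro u hu _ ⟨i, hi, rfl⟩
    rw [hT.lower i r hi (Nat.lt_succ_self _) u hu]
    exact zero_mem _
  · rintro _ ⟨k, hk, rfl⟩ u hu hmem _ ⟨i, hi, rfl⟩
    obtain ⟨c, d, hcd⟩ := h.exists_apply_cross hi hk
    rw [hcd]
    exact add_mem
      (Submodule.smul_mem _ _ (row_apply_mem_rowClosure hk (hmem _ ⟨i, hi, rfl⟩)))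
      (Submodule.smul_mem _ _ (hT.diag_or_block_apply_mem_rowClosure h (.inl rfl)
        (hT.diag_or_block_apply_mem_rowClosure h (.inr ⟨hi, hk⟩) hu)))

theorem blockStable_rowClosure (h : Straightening K X) (hT : BlockStable X (r + 1) T) :
    BlockStable X r (rowClosure X r T) where
  lower _ _ hji hjr _ hu := hT.lower_rowClosure h hji hjr hu
  diag _ _ hu := hT.diag_or_block_apply_mem_rowClosure h (.inl rfl) hu
  block i j hi hj u hu := by
    rcases (show r ≤ i from hi).eq_or_lt with rfl | hi <;>
      rcases (show _ ≤ j from hj).eq_or_lt with rfl | hj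
    · exact hT.diag_or_block_apply_mem_rowClosure h (.inl rfl) hu
    · exact row_apply_mem_rowClosure hj hu
    · exact hT.col_apply_mem_rowClosure h hi hu
    · exact hT.diag_or_block_apply_mem_rowClosure h (.inr ⟨hi, hj⟩) hu

theorem finrank_rowClosure_le (h : Straightening K X) {e : ℕ} (he : 0 < e)
    (hpow : ∀ k, r < k → X r k ^ e = 0) [FiniteDimensional K T] :
    FiniteDimensional K (rowClosure X r T) ∧
      Module.finrank K (rowClosure X r T) ≤
        e ^ (n - 1 - r) * Module.finrank K T := by
  classical
  have hF : {f | ∃ k, r < k ∧ f = X r k} =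
      (((Finset.Ioi r).image (X r) : Finset (Module.End K M)) : Set (Module.End K M)) := by
    ext f
    simp [eq_comm]
  rw [rowClosure, hF]
  obtain ⟨hfin, hrank⟩ := finrank_stableClosure_le (T := T) (e := e) ((Finset.Ioi r).image (X r))
    (by simpa using fun a _ b _ => h.skew r a r b (by simp) (by simp)) (by simpa using hpow)
  refine ⟨hfin, hrank.trans (Nat.mul_le_mul_right _ (Nat.pow_le_pow_right he ?_))⟩
  exact Finset.card_image_le.trans (Fin.card_Ioi r).le

/-- The closure of the line through `s` under the entries right of the diagonal, taken row by row
over the last `k` rows from bottom to top. -/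
def upperClosure (X : Fin n → Fin n → Module.End K M) (s : M) : ℕ → Submodule K M
  | 0 => K ∙ s
  | k + 1 => if h : k < n then rowClosure X (Fin.rev ⟨k, h⟩) (upperClosure X s k)
    else upperClosure X s k

theorem upperClosure_succ (X : Fin n → Fin n → Module.End K M) (s : M) {k : ℕ} (hk : k < n) :
    upperClosure X s (k + 1) =
      rowClosure X (Fin.rev ⟨k, hk⟩) (upperClosure X s k) := by
  rw [upperClosure, dif_pos hk]

variable {s : M}

theorem mem_upperClosure {k : ℕ} (hk : k ≤ n) : s ∈ upperClosure X s k := by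
  induction k with
  | zero => exact Submodule.mem_span_singleton_self s
  | succ k ih =>
    rw [upperClosure_succ X s hk]
    exact le_rowClosure (ih (Nat.le_of_succ_le hk))

theorem upperClosure_le {k : ℕ} (hk : k ≤ n) {Q : Submodule K M} (hs : s ∈ Q)
    (hQ : ∀ i j, i < j → ∀ u, X i j u ∈ Q) : upperClosure X s k ≤ Q := by
  induction k with
  | zero => simpa [upperClosure] using hs
  | succ k ih =>
    rw [upperClosure_succ X s hk]
    refine stableClosure_le (ih (Nat.le_of_succ_le hk)) ?_
    rintro _ ⟨j, hj, rfl⟩ u -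
    exact hQ _ j hj u

theorem blockStable_upperClosure (h : Straightening K X) (hlow : ∀ i j, j < i → X i j s = 0)
    (hdiag : ∀ i, ∃ c : K, X i i s = c • s) {k : ℕ} (hk : k ≤ n) :
    BlockStable X (n - k) (upperClosure X s k) := by
  induction k with
  | zero =>
    refine ⟨fun i j hji _ u hu => ?_, fun i u hu => ?_, fun i _ hi => absurd i.2 (not_lt.2 hi)⟩
    · obtain ⟨c, rfl⟩ := Submodule.mem_span_singleton.1 hu
      rw [map_smul, hlow i j hji, smul_zero]
    · obtain ⟨c, rfl⟩ := Submodule.mem_span_singleton.1 hu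
      obtain ⟨d, hd⟩ := hdiag i
      rw [map_smul, hd]
      exact Submodule.smul_mem _ _ (Submodule.smul_mem _ _ (Submodule.mem_span_singleton_self s))
  | succ k ih =>
    rw [upperClosure_succ X s hk]
    have hrev : ((Fin.rev ⟨k, hk⟩ : Fin n) : ℕ) = n - (k + 1) := rfl
    rw [← hrev]
    refine blockStable_rowClosure h ?_
    rw [hrev, show n - (k + 1) + 1 = n - k by omega]
    exact ih (Nat.le_of_succ_le hk)

theorem apply_mem_upperClosure (h : Straightening K X) (hlow : ∀ i j, j < i → X i j s = 0)
    (hdiag : ∀ i, ∃ c : K, X i i s = c • s) (i j : Fin n) {u : M}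
    (hu : u ∈ upperClosure X s n) : X i j u ∈ upperClosure X s n :=
  (blockStable_upperClosure h hlow hdiag le_rfl).block i j (by simp) (by simp) u hu

theorem finrank_upperClosure_le (h : Straightening K X) {e : ℕ} (he : 0 < e)
    (hpow : ∀ i j, i < j → X i j ^ e = 0) {k : ℕ} (hk : k ≤ n) :
    FiniteDimensional K (upperClosure X s k) ∧
      Module.finrank K (upperClosure X s k) ≤ e ^ ∑ i ∈ Finset.range k, i := by
  induction k with
  | zero =>
    change FiniteDimensional K (K ∙ s) ∧ Module.finrank K (K ∙ s) ≤ _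
    exact ⟨inferInstance, by simpa using finrank_span_le_card (R := K) ({s} : Set M)⟩
  | succ k ih =>
    obtain ⟨_, hrank⟩ := ih (Nat.le_of_succ_le hk)
    obtain ⟨hfin, hle⟩ := finrank_rowClosure_le (T := upperClosure X s k) h he
      (hpow (Fin.rev ⟨k, hk⟩))
    rw [upperClosure_succ X s hk]
    refine ⟨hfin, hle.trans ?_⟩
    rw [Finset.sum_range_succ, add_comm, pow_add]
    refine Nat.mul_le_mul (Nat.pow_le_pow_right he ?_) hrank
    simp only [Fin.val_rev]
    omega

section Superdiagonal

variable {c : Fin n → K} {a b : Fin n}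

theorem lower_superdiag_apply_eq_zero (h : Straightening K X) (hlow : ∀ i j, j < i → X i j s = 0)
    (hdiag : ∀ i, X i i s = c i • s) (hab : (b : ℕ) = a + 1) (hc : c a * c b = 0) {i j : Fin n}
    (hji : j < i) : X i j (X a b s) = 0 := by
  by_cases hij : a < i ∧ j < b
  · obtain ⟨p, p', hp⟩ := h.exists_apply_cross hij.1 hij.2
    rw [hp, hlow i j hji, map_zero, smul_zero, zero_add]
    rcases (show b ≤ i by omega).eq_or_lt with rfl | hbi
    · rcases (show j ≤ a by omega).eq_or_lt with rfl | hja
      · rw [hdiag, map_smul, hdiag, smul_smul (c _), mul_comm, hc, zero_smul, smul_zero]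
      · rw [hdiag, map_smul, hlow a j hja, smul_zero, smul_zero]
    · rw [hlow i b hbi, map_zero, smul_zero]
  · obtain ⟨p, hp⟩ := (h.skew i j a b (by omega) hij).exists_apply
    rw [hp, hlow i j hji, map_zero, smul_zero]

theorem exists_diag_superdiag_apply (h : Straightening K X) (hdiag : ∀ i, X i i s = c i • s)
    (hab : (b : ℕ) = a + 1) (i : Fin n) : ∃ p : K, X i i (X a b s) = p • X a b s := by
  obtain ⟨p, hp⟩ := (h.skew i i a b (by omega) (by omega)).exists_apply
  exact ⟨p * c i, by rw [hp, hdiag, map_smul, smul_smul]⟩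

end Superdiagonal

end Straightening

/-- The relation `y i * y s = q • (y s * y i)` for `i < s` in a column of a quantum matrix. -/
def IsQuantumColumn {K R ι : Type*} [Field K] [Ring R] [Algebra K R] [LT ι] (q : K) (y : ι → R) :
    Prop :=
  ∀ i s, i < s → y i * y s = q • (y s * y i)

/-- The relations between the entries of two columns of a quantum matrix, where `y` is to the left
of `z`. -/
structure IsQuantumColumnPair {K R ι : Type*} [Field K] [Ring R] [Algebra K R] [LT ι] (q : K)
    (y z : ι → R) : Prop where
  row : ∀ i, y i * z i = q • (z i * y i)
  anti : ∀ i s, i < s → z i * y s = y s * z i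
  diag : ∀ i s, i < s → y i * z s = z s * y i + (q - q⁻¹) • (z i * y s)

/-- The relations of the standard quantized matrix algebra, grouped by columns. -/
structure IsQuantumMatrix {K R ι κ : Type*} [Field K] [Ring R] [Algebra K R] [LT ι] [LT κ] (q : K)
    (Y : ι → κ → R) : Prop where
  column : ∀ j, IsQuantumColumn q fun i => Y i j
  pair : ∀ j t, j < t → IsQuantumColumnPair q (fun i => Y i j) fun i => Y i t

/-- The relations `a b = q b a`, `b d = q d b` and `a d = d a + (q - q⁻¹) b²` of the entries of a
symmetric quantum `2 × 2` matrix `(a, b; b, d)`. -/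
structure IsQuantumBlock {K R : Type*} [Field K] [Ring R] [Algebra K R] (q : K) (a b d : R) :
    Prop where
  left : a * b = q • (b * a)
  right : b * d = q • (d * b)
  diag : a * d = d * a + (q - q⁻¹) • (b * b)

section Columns

variable {K R ι : Type*} [Field K] [Ring R] [Algebra K R] [LT ι] {q : K} {u y z : ι → R}
  {a b d : R}

theorem IsQuantumColumn.add_mul (hq : q ≠ 0) (hy : IsQuantumColumn q y) (hz : IsQuantumColumn q z)
    (h : IsQuantumColumnPair q y z) (hab : a * b = q • (b * a))
    (hay : ∀ i, Commute a (y i)) (haz : ∀ i, Commute a (z i)) (hby : ∀ i, Commute b (y i))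
    (hbz : ∀ i, Commute b (z i)) : IsQuantumColumn q fun i => y i * a + z i * b := by
  intro i s his
  have aa := fun i => (hay i).mul_mul_mul_comm
  have az := fun i => (haz i).mul_mul_mul_comm
  have bb := fun i => (hby i).mul_mul_mul_comm
  have bz := fun i => (hbz i).mul_mul_mul_comm
  simp only [_root_.add_mul, mul_add, aa, az, bb, bz, hy i s his, hz i s his, h.diag i s his,
    h.anti i s his, hab]
  simp only [smul_mul_assoc, mul_smul_comm, smul_add, smul_smul]
  match_scalars <;> field_simp
  ring

theorem IsQuantumColumnPair.add_mul_left (hy : IsQuantumColumnPair q y u)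
    (hz : IsQuantumColumnPair q z u) (ha : ∀ i, Commute a (u i)) (hb : ∀ i, Commute b (u i)) :
    IsQuantumColumnPair q (fun i => y i * a + z i * b) u where
  row i := by
    simp only [add_mul, mul_add, mul_assoc, (ha i).eq, (hb i).eq]
    simp only [← mul_assoc, hy.row, hz.row, smul_add, smul_mul_assoc]
  anti i s his := by
    simp only [add_mul, mul_add, mul_assoc, (ha i).eq, (hb i).eq]
    simp only [← mul_assoc, hy.anti i s his, hz.anti i s his]
  diag i s his := by
    simp only [add_mul, mul_add, mul_assoc, (ha s).eq, (hb s).eq]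
    simp only [← mul_assoc, hy.diag i s his, hz.diag i s his, smul_add, add_mul, smul_mul_assoc]
    abel

theorem IsQuantumColumnPair.add_mul_right (hy : IsQuantumColumnPair q u y)
    (hz : IsQuantumColumnPair q u z) (ha : ∀ i, Commute a (u i)) (hb : ∀ i, Commute b (u i)) :
    IsQuantumColumnPair q u fun i => y i * a + z i * b where
  row i := by
    simp only [add_mul, mul_add, mul_assoc, (ha i).eq, (hb i).eq]
    simp only [← mul_assoc, hy.row, hz.row, smul_add, smul_mul_assoc]
  anti i s his := by
    simp only [add_mul, mul_add, mul_assoc, (ha s).eq, (hb s).eq]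
    simp only [← mul_assoc, hy.anti i s his, hz.anti i s his]
  diag i s his := by
    simp only [add_mul, mul_add, mul_assoc, (ha i).eq, (hb i).eq, (ha s).eq, (hb s).eq]
    simp only [← mul_assoc, hy.diag i s his, hz.diag i s his, smul_add, add_mul, smul_mul_assoc]
    abel

theorem IsQuantumColumnPair.mul_block (hq : q ≠ 0) (hy : IsQuantumColumn q y)
    (hz : IsQuantumColumn q z) (h : IsQuantumColumnPair q y z) (hblock : IsQuantumBlock q a b d)
    (ha : ∀ i, Commute a (y i) ∧ Commute a (z i)) (hb : ∀ i, Commute b (y i) ∧ Commute b (z i))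
    (hd : ∀ i, Commute d (y i) ∧ Commute d (z i)) :
    IsQuantumColumnPair q (fun i => y i * a + z i * b) fun i => y i * b + z i * d := by
  have ay := fun i => (ha i).1.mul_mul_mul_comm
  have az := fun i => (ha i).2.mul_mul_mul_comm
  have bb := fun i => (hb i).1.mul_mul_mul_comm
  have bz := fun i => (hb i).2.mul_mul_mul_comm
  have dy := fun i => (hd i).1.mul_mul_mul_comm
  have dz := fun i => (hd i).2.mul_mul_mul_comm
  refine ⟨fun i => ?_, fun i s his => ?_, fun i s his => ?_⟩
  · simp only [add_mul, mul_add, ay, az, bb, bz, dy, dz, h.row, hblock.left, hblock.right,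
      hblock.diag]
    simp only [smul_mul_assoc, mul_smul_comm, smul_add, smul_smul]
    match_scalars <;> field_simp
    all_goals ring
  · simp only [add_mul, mul_add, ay, az, bb, bz, dy, dz, hy i s his, hz i s his, h.diag i s his,
      h.anti i s his, hblock.left, hblock.right, hblock.diag]
    simp only [smul_mul_assoc, mul_smul_comm]
    match_scalars <;> field_simp
  · simp only [add_mul, mul_add, ay, az, bb, bz, dy, dz, hy i s his, hz i s his, h.diag i s his,
      h.anti i s his, hblock.left, hblock.right, hblock.diag]
    simp only [smul_mul_assoc, mul_smul_comm, smul_add, smul_smul]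
    match_scalars <;> field_simp <;> ring

end Columns

section QuantumMatrix

variable {K R S ι κ : Type*} [Field K] [Ring R] [Algebra K R] [Ring S] [Algebra K S] {q : K}

theorem IsQuantumMatrix.map [LT ι] [LT κ] {Y : ι → κ → R} (h : IsQuantumMatrix q Y)
    (f : R →ₐ[K] S) : IsQuantumMatrix q fun i j => f (Y i j) where
  column j i s his := by rw [← map_mul, h.column j i s his, map_smul, map_mul]
  pair _ _ hjt :=
    { row := fun _ => by rw [← map_mul, (h.pair _ _ hjt).row, map_smul, map_mul]
      anti := fun _ _ his => by rw [← map_mul, (h.pair _ _ hjt).anti _ _ his, map_mul]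
      diag := fun i s his => by simp only [← map_mul, (h.pair _ _ hjt).diag i s his, map_add,
        map_smul] }

theorem IsQuantumMatrix.reindex [Preorder ι] [Preorder κ] {ι' κ' : Type*} [Preorder ι']
    [Preorder κ'] {Y : ι → κ → R} (h : IsQuantumMatrix q Y) {f : ι' → ι} {g : κ' → κ}
    (hf : StrictMono f) (hg : StrictMono g) : IsQuantumMatrix q fun i j => Y (f i) (g j) where
  column j i s his := h.column (g j) (f i) (f s) (hf his)
  pair _ _ hjt :=
    { row := fun i => (h.pair _ _ (hg hjt)).row (f i)
      anti := fun _ _ his => (h.pair _ _ (hg hjt)).anti _ _ (hf his)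
      diag := fun _ _ his => (h.pair _ _ (hg hjt)).diag _ _ (hf his) }

theorem IsQuantumMatrix.smul [LT ι] [LT κ] {Y : ι → κ → R} (h : IsQuantumMatrix q Y) (r : ι → K)
    (c : κ → K) : IsQuantumMatrix q fun i j => (r i * c j) • Y i j where
  column j i s his := by
    simp only [smul_mul_smul_comm, h.column j i s his, smul_smul]
    congr 1
    ring
  pair j t hjt :=
    { row := fun i => by
        simp only [smul_mul_smul_comm, (h.pair j t hjt).row i, smul_smul]
        congr 1
        ring
      anti := fun i s his => by
        simp only [smul_mul_smul_comm, (h.pair j t hjt).anti i s his]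
        congr 1
        ring
      diag := fun i s his => by
        simp only [smul_mul_smul_comm, (h.pair j t hjt).diag i s his, smul_add, smul_smul]
        congr 2 <;> ring }

/-- Right multiplication of a matrix by the block `(a, b; b, d)` in the columns `l`, `l + 1`. -/
def blockColumns (Y : ι → ℕ → R) (l : ℕ) (a b d : R) (i : ι) (j : ℕ) : R :=
  if j = l then Y i l * a + Y i (l + 1) * b
  else if j = l + 1 then Y i l * b + Y i (l + 1) * d
  else Y i j

variable {Y : ι → ℕ → R} {l : ℕ} {a b d : R}

theorem blockColumns_left (i : ι) : blockColumns Y l a b d i l = Y i l * a + Y i (l + 1) * b := by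
  simp [blockColumns]

theorem blockColumns_right (i : ι) :
    blockColumns Y l a b d i (l + 1) = Y i l * b + Y i (l + 1) * d := by
  simp [blockColumns]

theorem blockColumns_of_ne (i : ι) {j : ℕ} (h1 : j ≠ l) (h2 : j ≠ l + 1) :
    blockColumns Y l a b d i j = Y i j := by
  simp [blockColumns, h1, h2]

theorem IsQuantumMatrix.blockColumns [LT ι] (hq : q ≠ 0) (h : IsQuantumMatrix q Y)
    (hblock : IsQuantumBlock q a b d) (ha : ∀ i j, Commute a (Y i j))
    (hb : ∀ i j, Commute b (Y i j)) (hd : ∀ i j, Commute d (Y i j)) :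
    IsQuantumMatrix q (blockColumns Y l a b d) := by
  have hl : l < l + 1 := l.lt_succ_self
  have cases_column : ∀ j, j = l ∨ j = l + 1 ∨ (j ≠ l ∧ j ≠ l + 1) := by omega
  refine ⟨fun j => ?_, fun j t hjt => ?_⟩
  · rcases cases_column j with rfl | rfl | ⟨hj, hj'⟩
    · simp only [blockColumns_left]
      exact (h.column j).add_mul hq (h.column (j + 1)) (h.pair j (j + 1) hl) hblock.left
        (ha · j) (ha · (j + 1)) (hb · j) (hb · (j + 1))
    · simp only [blockColumns_right]
      exact (h.column l).add_mul hq (h.column (l + 1)) (h.pair l (l + 1) hl) hblock.right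
        (hb · l) (hb · (l + 1)) (hd · l) (hd · (l + 1))
    · simp only [blockColumns_of_ne _ hj hj']
      exact h.column j
  · rcases cases_column j with rfl | rfl | ⟨hj, hj'⟩ <;>
      rcases cases_column t with rfl | rfl | ⟨ht, ht'⟩ <;> try omega
    · simp only [blockColumns_left, blockColumns_right]
      exact (h.pair j (j + 1) hl).mul_block hq (h.column j) (h.column (j + 1)) hblock
        (fun i => ⟨ha i j, ha i (j + 1)⟩) (fun i => ⟨hb i j, hb i (j + 1)⟩)
        fun i => ⟨hd i j, hd i (j + 1)⟩
    · simp only [blockColumns_left, blockColumns_of_ne _ ht ht']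
      exact (h.pair j t hjt).add_mul_left (h.pair (j + 1) t (by omega)) (ha · t) (hb · t)
    · simp only [blockColumns_right, blockColumns_of_ne _ ht ht']
      exact (h.pair l t (by omega)).add_mul_left (h.pair (l + 1) t hjt) (hb · t) (hd · t)
    · simp only [blockColumns_left, blockColumns_of_ne _ hj hj']
      exact (h.pair j t hjt).add_mul_right (h.pair j (t + 1) (by omega)) (ha · j) (hb · j)
    · simp only [blockColumns_right, blockColumns_of_ne _ hj hj']
      exact (h.pair j l (by omega)).add_mul_right (h.pair j (l + 1) hjt) (hb · j) (hd · j)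
    · simp only [blockColumns_of_ne _ hj hj', blockColumns_of_ne _ ht ht']
      exact h.pair j t hjt

/-- The block matrix `1 ⊕ Z`. -/
def oneSum (Z : ℕ → ℕ → R) : ℕ → ℕ → R
  | 0, 0 => 1
  | 0, _ + 1 => 0
  | _ + 1, 0 => 0
  | i + 1, j + 1 => Z i j

theorem IsQuantumMatrix.oneSum {Z : ℕ → ℕ → R} (h : IsQuantumMatrix q Z) :
    IsQuantumMatrix q (oneSum Z) where
  column := by
    rintro (_ | j) (_ | i) (_ | s) his
    any_goals omega
    all_goals simp only [_root_.oneSum, zero_mul, mul_zero, smul_zero]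
    exact h.column j i s (by omega)
  pair := by
    rintro (_ | j) (_ | t) hjt
    any_goals omega
    · refine ⟨?_, ?_, ?_⟩
      · rintro (_ | i) <;> simp [_root_.oneSum]
      · rintro (_ | i) (_ | s) _ <;> simp [_root_.oneSum]
      · rintro (_ | i) (_ | s) his <;> first | omega | simp [_root_.oneSum]
    · have hpair := h.pair j t (by omega)
      refine ⟨?_, ?_, ?_⟩
      · rintro (_ | i) <;> simp [_root_.oneSum, hpair.row]
      · rintro (_ | i) (_ | s) his
        · omega
        · simp only [_root_.oneSum, zero_mul, mul_zero]
        · omega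
        · exact hpair.anti i s (by omega)
      · rintro (_ | i) (_ | s) his
        any_goals omega
        · simp [_root_.oneSum]
        · exact hpair.diag i s (by omega)

end QuantumMatrix

section Oscillator

variable {K U : Type*} [Field K] [AddCommGroup U] [Module K U] {e : ℕ}

/-- The raising operator of the `q`-oscillator truncated at level `e`, with multiplicity space
`U`. -/
def oscRaise (K : Type*) (e : ℕ) (U : Type*) [Field K] [AddCommGroup U] [Module K U] :
    Module.End K (Fin (e + 1) → U) where
  toFun g := Fin.cases 0 fun p : Fin e => g p.castSucc
  map_add' f g := by
    funext p
    refine Fin.cases ?_ (fun p => ?_) p <;> simp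
  map_smul' c g := by
    funext p
    refine Fin.cases ?_ (fun p => ?_) p <;> simp

/-- The operator `q ^ (-N)` of the truncated `q`-oscillator, where `N` is the number operator. -/
def oscScale {K : Type*} (q : K) (e : ℕ) (U : Type*) [Field K] [AddCommGroup U] [Module K U] :
    Module.End K (Fin (e + 1) → U) where
  toFun g p := (q ^ (p : ℕ))⁻¹ • g p
  map_add' f g := by
    funext p
    simp
  map_smul' c g := by
    funext p
    simp [smul_smul, mul_comm]

/-- The coefficient of the lowering operator from level `p` to level `p - 1`. It is determined by
`oscRaise_mul_oscLower` and `oscCoeff q 0 = 0`, and vanishes again at level `e + 1` if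
`q ^ (2 * (e + 1)) = 1`, which allows the truncation. -/
def oscCoeff {K : Type*} [Field K] (q : K) (p : ℕ) : K := q * ((q ^ (2 * p))⁻¹ - 1)

/-- The lowering operator of the truncated `q`-oscillator. -/
def oscLower {K : Type*} (q : K) (e : ℕ) (U : Type*) [Field K] [AddCommGroup U] [Module K U] :
    Module.End K (Fin (e + 1) → U) where
  toFun g := Fin.lastCases 0 fun p : Fin e => oscCoeff q (p + 1) • g p.succ
  map_add' f g := by
    funext p
    refine Fin.lastCases ?_ (fun p => ?_) p <;> simp
  map_smul' c g := by
    funext p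
    refine Fin.lastCases ?_ (fun p => ?_) p <;> simp [smul_smul, mul_comm]

@[simp] theorem oscRaise_zero (g : Fin (e + 1) → U) : oscRaise K e U g 0 = 0 := rfl

@[simp] theorem oscRaise_succ (g : Fin (e + 1) → U) (p : Fin e) :
    oscRaise K e U g p.succ = g p.castSucc := rfl

@[simp] theorem oscScale_apply (q : K) (g : Fin (e + 1) → U) (p : Fin (e + 1)) :
    oscScale q e U g p = (q ^ (p : ℕ))⁻¹ • g p := rfl

@[simp] theorem oscLower_last (q : K) (g : Fin (e + 1) → U) :
    oscLower q e U g (Fin.last e) = 0 := by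
  simp [oscLower]

@[simp] theorem oscLower_castSucc (q : K) (g : Fin (e + 1) → U) (p : Fin e) :
    oscLower q e U g p.castSucc = oscCoeff q (p + 1) • g p.succ := by
  simp [oscLower]

theorem oscRaise_mul_oscScale {q : K} (hq : q ≠ 0) :
    oscRaise K e U * oscScale q e U = q • (oscScale q e U * oscRaise K e U) := by
  refine LinearMap.ext fun g => funext fun p => ?_
  refine Fin.cases ?_ (fun p => ?_) p
  · simp
  · simp only [Module.End.mul_apply, oscRaise_succ, oscScale_apply, Fin.val_castSucc,
      LinearMap.smul_apply, Pi.smul_apply, Fin.val_succ, smul_smul, pow_succ]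
    congr 1
    field_simp

theorem oscScale_mul_oscLower {q : K} (hq : q ≠ 0) :
    oscScale q e U * oscLower q e U = q • (oscLower q e U * oscScale q e U) := by
  refine LinearMap.ext fun g => funext fun p => ?_
  refine Fin.lastCases ?_ (fun p => ?_) p
  · simp
  · simp only [Module.End.mul_apply, oscLower_castSucc, oscScale_apply, Fin.val_castSucc,
      LinearMap.smul_apply, Pi.smul_apply, Fin.val_succ, smul_smul, pow_succ]
    congr 1
    field_simp

theorem oscRaise_oscLower_apply (q : K) (g : Fin (e + 1) → U) (p : Fin (e + 1)) :
    oscRaise K e U (oscLower q e U g) p = oscCoeff q p • g p := by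
  refine Fin.cases ?_ (fun p => ?_) p <;> simp [oscCoeff]

theorem oscLower_oscRaise_apply {q : K} (hq : q ^ (2 * (e + 1)) = 1) (g : Fin (e + 1) → U)
    (p : Fin (e + 1)) :
    oscLower q e U (oscRaise K e U g) p = oscCoeff q (p + 1) • g p := by
  refine Fin.lastCases ?_ (fun p => ?_) p
  · simp [oscCoeff, hq]
  · simp

theorem oscRaise_mul_oscLower {q : K} (hq0 : q ≠ 0) (hq : q ^ (2 * (e + 1)) = 1) :
    oscRaise K e U * oscLower q e U = oscLower q e U * oscRaise K e U +
      (q - q⁻¹) • (oscScale q e U * oscScale q e U) := by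
  refine LinearMap.ext fun g => funext fun p => ?_
  simp only [Module.End.mul_apply, LinearMap.add_apply, LinearMap.smul_apply, Pi.add_apply,
    Pi.smul_apply, oscRaise_oscLower_apply, oscLower_oscRaise_apply hq, oscScale_apply, smul_smul,
    ← add_smul]
  congr 1
  simp only [oscCoeff, mul_add, pow_add, mul_one, mul_comm 2 (p : ℕ), pow_mul]
  field_simp
  ring

theorem oscRaise_pow : oscRaise K e U ^ (e + 1) = 0 := by
  have apply_eq_zero : ∀ (k : ℕ) (g : Fin (e + 1) → U) (p : Fin (e + 1)), (p : ℕ) < k →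
      (oscRaise K e U ^ k) g p = 0 := by
    intro k
    induction k with
    | zero => intro g p hp; omega
    | succ k ih =>
      intro g p
      rw [pow_succ', Module.End.mul_apply]
      refine Fin.cases ?_ (fun p => ?_) p
      · simp
      · intro hp
        rw [oscRaise_succ]
        exact ih _ _ (by simpa using hp)
  exact LinearMap.ext fun g => funext fun p => apply_eq_zero _ g p p.2

theorem oscScale_injective {q : K} (hq : q ≠ 0) : Function.Injective (oscScale q e U) := by
  intro f g h
  funext p
  have := congr_fun h p
  simpa [hq] using this

theorem oscScale_surjective {q : K} (hq : q ≠ 0) : Function.Surjective (oscScale q e U) := by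
  intro g
  refine ⟨fun p => q ^ (p : ℕ) • g p, funext fun p => ?_⟩
  simp [smul_smul, hq]

theorem eq_zero_of_oscLower_eq_zero {q : K} (hq0 : q ≠ 0)
    (hq : ∀ p, 0 < p → p < e + 1 → q ^ (2 * p) ≠ 1) {g : Fin (e + 1) → U}
    (h : oscLower q e U g = 0) (p : Fin e) : g p.succ = 0 := by
  have h1 := congr_fun h p.castSucc
  rw [oscLower_castSucc, Pi.zero_apply, smul_eq_zero] at h1
  refine h1.resolve_left ?_
  refine mul_ne_zero hq0 (sub_ne_zero.2 fun h2 => hq (p + 1) (Nat.succ_pos _) (by omega)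
    (inv_eq_one.1 h2))

theorem isQuantumBlock_osc {q : K} (hq0 : q ≠ 0) (hq : q ^ (2 * (e + 1)) = 1) :
    IsQuantumBlock q (oscRaise K e U) (oscScale q e U) (oscLower q e U) :=
  ⟨oscRaise_mul_oscScale hq0, oscScale_mul_oscLower hq0, oscRaise_mul_oscLower hq0 hq⟩

-- The quantum determinant of the oscillator block is a nonzero scalar.
theorem oscScale_mul_oscScale {q : K} (hq0 : q ≠ 0) (hq : q ^ (2 * (e + 1)) = 1) :
    oscScale q e U * oscScale q e U =
      q • (oscLower q e U * oscRaise K e U) + (q ^ 2 • 1 : Module.End K (Fin (e + 1) → U)) := by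
  refine LinearMap.ext fun g => funext fun p => ?_
  simp only [Module.End.mul_apply, LinearMap.add_apply, LinearMap.smul_apply, Pi.add_apply,
    Pi.smul_apply, oscLower_oscRaise_apply hq, oscScale_apply, smul_smul, Module.End.one_apply,
    ← add_smul]
  congr 1
  simp only [oscCoeff, mul_add, pow_add, mul_one, mul_comm 2 (p : ℕ), pow_mul]
  field_simp
  ring

theorem eq_zero_of_oscBlock_eq_zero {q : K} (hq0 : q ≠ 0) (hq : q ^ (2 * (e + 1)) = 1)
    {f g : Fin (e + 1) → U} (h1 : oscRaise K e U f + oscScale q e U g = 0)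
    (h2 : oscScale q e U f + oscLower q e U g = 0) : f = 0 ∧ g = 0 := by
  have hf : q ^ 2 • f = 0 := by
    have hdet := LinearMap.congr_fun (oscScale_mul_oscScale (U := U) hq0 hq) f
    have hcomm := LinearMap.congr_fun (oscScale_mul_oscLower (U := U) (e := e) hq0) g
    simp only [Module.End.mul_apply, LinearMap.add_apply, LinearMap.smul_apply,
      Module.End.one_apply] at hdet hcomm
    calc q ^ 2 • f
        = oscScale q e U (oscScale q e U f + oscLower q e U g) -
            q • oscLower q e U (oscRaise K e U f + oscScale q e U g) := by
          rw [map_add, map_add, hdet, hcomm]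
          module
      _ = 0 := by rw [h1, h2, map_zero, map_zero, smul_zero, sub_zero]
  have hf : f = 0 := (smul_eq_zero.1 hf).resolve_left (pow_ne_zero 2 hq0)
  rw [hf, map_zero, zero_add] at h1
  exact ⟨hf, oscScale_injective hq0 (by rw [h1, map_zero])⟩

theorem oscRaise_single_castSucc (p : Fin e) (x : U) :
    oscRaise K e U (Pi.single p.castSucc x) = Pi.single p.succ x := by
  funext r
  refine Fin.cases ?_ (fun r => ?_) r
  · rw [oscRaise_zero, Pi.single_eq_of_ne (Fin.succ_ne_zero p).symm]
  · rw [oscRaise_succ]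
    rcases eq_or_ne r p with rfl | h
    · simp
    · rw [Pi.single_eq_of_ne (by simpa using h), Pi.single_eq_of_ne (by simpa using h)]

theorem oscScale_single_zero (q : K) (x : U) :
    oscScale q e U (Pi.single 0 x) = Pi.single 0 x := by
  funext r
  rcases eq_or_ne r 0 with rfl | h
  · simp
  · simp [Pi.single_eq_of_ne h]

theorem oscLower_single_zero (q : K) (x : U) : oscLower q e U (Pi.single 0 x) = 0 := by
  funext r
  refine Fin.lastCases ?_ (fun r => ?_) r
  · simp
  · rw [oscLower_castSucc, Pi.single_eq_of_ne (Fin.succ_ne_zero r)]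
    simp

end Oscillator

section PiEnd

variable {K U κ : Type*} [Field K] [AddCommGroup U] [Module K U]

/-- The diagonal action of the endomorphisms of `U` on functions with values in `U`. -/
def piEnd (K U κ : Type*) [Field K] [AddCommGroup U] [Module K U] :
    Module.End K U →ₐ[K] Module.End K (κ → U) where
  toFun f := f.compLeft κ
  map_one' := rfl
  map_mul' _ _ := rfl
  map_zero' := rfl
  map_add' _ _ := rfl
  commutes' _ := rfl

@[simp] theorem piEnd_apply (f : Module.End K U) (g : κ → U) (p : κ) :
    piEnd K U κ f g p = f (g p) := rfl

theorem piEnd_single [DecidableEq κ] (f : Module.End K U) (p : κ) (x : U) :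
    piEnd K U κ f (Pi.single p x) = Pi.single p (f x) :=
  funext (Pi.apply_single (fun _ => f) (fun _ => map_zero f) p x)

variable {e : ℕ}

theorem commute_oscRaise_piEnd (f : Module.End K U) : Commute (oscRaise K e U) (piEnd K U _ f) := by
  refine LinearMap.ext fun g => funext fun p => ?_
  refine Fin.cases ?_ (fun p => ?_) p <;> simp

theorem commute_oscScale_piEnd (q : K) (f : Module.End K U) :
    Commute (oscScale q e U) (piEnd K U _ f) :=
  LinearMap.ext fun g => funext fun p => by simp

theorem commute_oscLower_piEnd (q : K) (f : Module.End K U) :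
    Commute (oscLower q e U) (piEnd K U _ f) := by
  refine LinearMap.ext fun g => funext fun p => ?_
  refine Fin.lastCases ?_ (fun p => ?_) p <;> simp

end PiEnd

universe u v

section FockRep

variable {K : Type u} [Field K] {V : Type v} [AddCommGroup V] [Module K V]

/-- The properties of the Fock representation of the quantized matrix algebra of size `n`, with
oscillators truncated at level `e` and vacuum vector `v`. Indices start at `0` and only the entries
with indices below `n` are relevant; "lower" and "upper" refer to the antidiagonal. -/
structure IsFockRep (q : K) (e n : ℕ) (Z : ℕ → ℕ → Module.End K V) (v : V) : Prop where
  rel : IsQuantumMatrix q Z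
  inj : ∀ w : ℕ → V, (∀ i < n, ∑ j ∈ Finset.range n, Z i j (w j) = 0) → ∀ j < n, w j = 0
  lower : ∀ i < n, ∀ j < n, n ≤ i + j → Z i j v = 0
  diag : ∀ i j, i + j + 1 = n → Z i j v = v
  upper_pow : ∀ i j, i + j + 1 < n → (Z i j ^ (e + 1)) v = 0
  cyclic : ∀ p : Submodule K V, v ∈ p → (∀ i < n, ∀ j < n, ∀ u ∈ p, Z i j u ∈ p) → p = ⊤
  finite : FiniteDimensional K V
  finrank : Module.finrank K V = (e + 1) ^ ∑ i ∈ Finset.range n, i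
  singular : ∀ u, (∀ i < n, ∀ j < n, n ≤ i + j → Z i j u = 0) → ∃ c : K, u = c • v

/-- The properties of the matrix `Y = (1 ⊕ Z) G₀ ⋯ Gₗ₋₁` of operators on `U`, where `Z` acts on `V`
and `Gⱼ` is an oscillator block in the columns `j` and `j + 1`. The map `ι` embeds `V` as the
subspace where all `l` new oscillators are in their ground state. -/
structure IsFockStage {U : Type v} [AddCommGroup U] [Module K U] (q : K) (e n l : ℕ)
    (Z : ℕ → ℕ → Module.End K V) (Y : ℕ → ℕ → Module.End K U) (ι : V →ₗ[K] U) : Prop where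
  rel : IsQuantumMatrix q Y
  inj : ∀ w : ℕ → U, (∀ i < n + 1, ∑ j ∈ Finset.range (n + 1), Y i j (w j) = 0) →
    ∀ j < n + 1, w j = 0
  row_zero : ∀ j, l < j → Y 0 j = 0
  row_bijective : Function.Bijective (Y 0 l)
  row_ι : ∀ u, Y 0 l (ι u) = ι u
  row_pow : ∀ j < l, Y 0 j ^ (e + 1) = 0
  ι_injective : Function.Injective ι
  left : ∀ s j, j < l → ∀ u, Y (s + 1) j (ι u) = ι (Z s j u)
  middle : ∀ s u, Y (s + 1) l (ι u) = 0
  right : ∀ s j, l ≤ j → ∀ u, Y (s + 1) (j + 1) (ι u) = ι (Z s j u)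
  cyclic : ∀ p : Submodule K U, (∀ u, ι u ∈ p) → (∀ j < l, ∀ x ∈ p, Y 0 j x ∈ p) → p = ⊤
  finite : FiniteDimensional K U
  finrank : Module.finrank K U = (e + 1) ^ l * Module.finrank K V
  singular : ∀ (x : U) (w : ℕ → U),
    (∀ s < n, Y (s + 1) l x + ∑ j ∈ Finset.Ico l n, Y (s + 1) (j + 1) (w j) = 0) →
    (∃ u, ι u = x) ∧ ∀ j, l ≤ j → j < n → w j = 0

theorem isFockRep_zero (q : K) (e : ℕ) :
    IsFockRep q e 0 (0 : ℕ → ℕ → Module.End K K) 1 where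
  rel := ⟨fun _ _ _ _ => by simp, fun _ _ _ =>
    ⟨fun _ => by simp, fun _ _ _ => by simp, fun _ _ _ => by simp⟩⟩
  inj := by simp
  lower := by simp
  diag := by simp
  upper_pow := by simp
  cyclic p hv _ := eq_top_iff.2 fun x _ => by simpa using p.smul_mem x hv
  finite := inferInstance
  finrank := by simp
  singular u _ := ⟨u, by simp⟩

namespace IsFockRep

variable {q : K} {e n : ℕ} {Z : ℕ → ℕ → Module.End K V} {v : V}

theorem ne_zero (h : IsFockRep q e n Z v) : v ≠ 0 := by
  rintro rfl
  have hbot := h.cyclic ⊥ (zero_mem _) (by simp)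
  have hrank := h.finrank
  rw [← finrank_top, ← hbot, finrank_bot] at hrank
  exact (pow_pos e.succ_pos _).ne hrank

theorem superdiag_ne_zero (h : IsFockRep q e n Z v) (hq0 : q ≠ 0) (hq : q ^ 2 ≠ 1) {i j : ℕ}
    (hij : i + j + 2 = n) : Z i j v ≠ 0 := by
  intro h0
  have hrel := LinearMap.congr_fun
    ((h.rel.pair j (j + 1) j.lt_succ_self).diag i (i + 1) i.lt_succ_self) v
  simp only [Module.End.mul_apply, LinearMap.add_apply, LinearMap.smul_apply, h0, map_zero,
    h.lower (i + 1) (by omega) (j + 1) (by omega) (by omega), h.diag (i + 1) j (by omega),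
    h.diag i (j + 1) (by omega), zero_add] at hrel
  rcases smul_eq_zero.1 hrel.symm with hc | hv
  · refine hq ?_
    rw [sub_eq_zero] at hc
    rw [pow_two]
    nth_rw 1 [hc]
    exact inv_mul_cancel₀ hq0
  · exact h.ne_zero hv

theorem isFockStage_oneSum (h : IsFockRep q e n Z v) :
    IsFockStage q e n 0 Z (oneSum Z) LinearMap.id where
  rel := h.rel.oneSum
  inj w hw := by
    have sum_eq (i : ℕ) := Finset.sum_range_succ' (fun j => oneSum Z i j (w j)) n
    rintro (_ | j) hj
    · have := hw 0 n.succ_pos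
      rw [sum_eq] at this
      simpa [oneSum] using this
    · refine h.inj (fun j => w (j + 1)) (fun i hi => ?_) j (by omega)
      have := hw (i + 1) (by omega)
      rw [sum_eq] at this
      simpa [oneSum] using this
  row_zero := by
    rintro (_ | j) hj
    · omega
    · rfl
  row_bijective := Function.bijective_id
  row_ι _ := rfl
  row_pow _ hj := absurd hj (Nat.not_lt_zero _)
  ι_injective := Function.injective_id
  left _ _ hj := absurd hj (Nat.not_lt_zero _)
  middle _ _ := rfl
  right _ _ _ _ := rfl
  cyclic p hp _ := eq_top_iff.2 fun x _ => hp x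
  finite := h.finite
  finrank := by simp
  singular x w hw := by
    refine ⟨⟨x, rfl⟩, fun j _ => h.inj w (fun i hi => ?_) j⟩
    simpa [oneSum] using hw i hi

end IsFockRep

namespace IsFockStage

variable {U : Type v} [AddCommGroup U] [Module K U] {q : K} {e n l : ℕ}
  {Z : ℕ → ℕ → Module.End K V} {Y : ℕ → ℕ → Module.End K U} {ι : V →ₗ[K] U}

/-- The matrix `Y Gₗ`, where `Gₗ` is a new oscillator block in the columns `l` and `l + 1`. -/
def nextMatrix (q : K) (e l : ℕ) (Y : ℕ → ℕ → Module.End K U) :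
    ℕ → ℕ → Module.End K (Fin (e + 1) → U) :=
  blockColumns (fun i j => piEnd K U _ (Y i j)) l (oscRaise K e U) (oscScale q e U)
    (oscLower q e U)

theorem nextMatrix_left (i : ℕ) (g : Fin (e + 1) → U) :
    nextMatrix q e l Y i l g = piEnd K U _ (Y i l) (oscRaise K e U g) +
      piEnd K U _ (Y i (l + 1)) (oscScale q e U g) :=
  LinearMap.congr_fun (blockColumns_left i) g

theorem nextMatrix_right (i : ℕ) (g : Fin (e + 1) → U) :
    nextMatrix q e l Y i (l + 1) g = piEnd K U _ (Y i l) (oscScale q e U g) +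
      piEnd K U _ (Y i (l + 1)) (oscLower q e U g) :=
  LinearMap.congr_fun (blockColumns_right i) g

theorem nextMatrix_of_ne (i : ℕ) {j : ℕ} (h1 : j ≠ l) (h2 : j ≠ l + 1) :
    nextMatrix q e l Y i j = piEnd K U _ (Y i j) :=
  blockColumns_of_ne i h1 h2

theorem isQuantumMatrix_nextMatrix (h : IsFockStage q e n l Z Y ι) (hq0 : q ≠ 0)
    (hq : q ^ (2 * (e + 1)) = 1) : IsQuantumMatrix q (nextMatrix q e l Y) :=
  (h.rel.map (piEnd K U _)).blockColumns hq0 (isQuantumBlock_osc hq0 hq)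
    (fun _ _ => commute_oscRaise_piEnd _) (fun _ _ => commute_oscScale_piEnd _ _)
    fun _ _ => commute_oscLower_piEnd _ _

theorem nextMatrix_row_left (h : IsFockStage q e n l Z Y ι) :
    nextMatrix q e l Y 0 l = piEnd K U _ (Y 0 l) * oscRaise K e U := by
  rw [nextMatrix, blockColumns_left, h.row_zero (l + 1) l.lt_succ_self, map_zero, zero_mul,
    add_zero]

theorem nextMatrix_row_right (h : IsFockStage q e n l Z Y ι) :
    nextMatrix q e l Y 0 (l + 1) = piEnd K U _ (Y 0 l) * oscScale q e U := by
  rw [nextMatrix, blockColumns_right, h.row_zero (l + 1) l.lt_succ_self, map_zero, zero_mul,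
    add_zero]

theorem sum_nextMatrix_apply (hl : l < n) (i : ℕ) (w : ℕ → Fin (e + 1) → U) :
    ∑ j ∈ Finset.range (n + 1), nextMatrix q e l Y i j (w j) =
      ∑ j ∈ Finset.range (n + 1), piEnd K U _ (Y i j)
        (if j = l then oscRaise K e U (w l) + oscScale q e U (w (l + 1))
        else if j = l + 1 then oscScale q e U (w l) + oscLower q e U (w (l + 1))
        else w j) := by
  rw [← sub_eq_zero, ← Finset.sum_sub_distrib,
    Finset.sum_eq_add_of_mem l (l + 1) (by simp; omega) (by simp; omega) (by omega)]
  · simp only [nextMatrix_left, nextMatrix_right, if_true, l.succ_ne_self, if_false, map_add]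
    abel
  · intro j _ hj
    rw [nextMatrix_of_ne i hj.1 hj.2, if_neg hj.1, if_neg hj.2, sub_self]

theorem nextMatrix_injective (h : IsFockStage q e n l Z Y ι) (hq0 : q ≠ 0)
    (hq : q ^ (2 * (e + 1)) = 1) (hl : l < n) (w : ℕ → Fin (e + 1) → U)
    (hw : ∀ i < n + 1, ∑ j ∈ Finset.range (n + 1), nextMatrix q e l Y i j (w j) = 0) :
    ∀ j < n + 1, w j = 0 := by
  let w' : ℕ → Fin (e + 1) → U := fun j =>
    if j = l then oscRaise K e U (w l) + oscScale q e U (w (l + 1))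
    else if j = l + 1 then oscScale q e U (w l) + oscLower q e U (w (l + 1))
    else w j
  have block_eq_zero : ∀ j < n + 1, w' j = 0 := by
    refine fun j hj => funext fun p => h.inj (fun j => w' j p) (fun i hi => ?_) j hj
    have := congr_fun ((sum_nextMatrix_apply hl i w).symm.trans (hw i hi)) p
    rwa [Finset.sum_apply] at this
  obtain ⟨hleft, hright⟩ := eq_zero_of_oscBlock_eq_zero hq0 hq (f := w l) (g := w (l + 1))
    (by simpa [w'] using block_eq_zero l (by omega))
    (by simpa [w'] using block_eq_zero (l + 1) (by omega))
  intro j hj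
  rcases eq_or_ne j l with rfl | h1
  · exact hleft
  rcases eq_or_ne j (l + 1) with rfl | h2
  · exact hright
  · simpa [w', h1, h2] using block_eq_zero j hj

theorem nextMatrix_row_bijective (h : IsFockStage q e n l Z Y ι) (hq0 : q ≠ 0) :
    Function.Bijective (nextMatrix q e l Y 0 (l + 1)) := by
  rw [h.nextMatrix_row_right]
  have hscale : Function.Bijective (oscScale q e U) :=
    ⟨oscScale_injective hq0, oscScale_surjective hq0⟩
  have hpi : Function.Bijective (piEnd K U (Fin (e + 1)) (Y 0 l)) :=
    Function.Bijective.piMap fun _ => h.row_bijective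
  exact hpi.comp hscale

theorem nextMatrix_row_pow (h : IsFockStage q e n l Z Y ι) {j : ℕ} (hj : j < l + 1) :
    nextMatrix q e l Y 0 j ^ (e + 1) = 0 := by
  rcases (Nat.lt_succ_iff.1 hj).eq_or_lt with rfl | hj
  · rw [h.nextMatrix_row_left, (commute_oscRaise_piEnd _).symm.mul_pow, oscRaise_pow, mul_zero]
  · rw [nextMatrix_of_ne 0 (by omega) (by omega), ← map_pow, h.row_pow j hj, map_zero]

theorem nextMatrix_apply_left (h : IsFockStage q e n l Z Y ι) (s : ℕ) {j : ℕ} (hj : j < l + 1)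
    (u : V) : nextMatrix q e l Y (s + 1) j (Pi.single 0 (ι u)) = Pi.single 0 (ι (Z s j u)) := by
  rcases (Nat.lt_succ_iff.1 hj).eq_or_lt with rfl | hj
  · have hmiddle : piEnd K U _ (Y (s + 1) j) (Pi.single (0 : Fin (e + 1)) (ι u)) = 0 := by
      rw [piEnd_single, h.middle, Pi.single_zero]
    have hraise := LinearMap.congr_fun (commute_oscRaise_piEnd (e := e) (Y (s + 1) j)).eq
      (Pi.single 0 (ι u))
    rw [Module.End.mul_apply, Module.End.mul_apply, hmiddle, map_zero] at hraise
    rw [nextMatrix_left, ← hraise, zero_add, oscScale_single_zero, piEnd_single,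
      h.right s j le_rfl]
  · rw [nextMatrix_of_ne _ (by omega) (by omega), piEnd_single, h.left s j hj]

theorem nextMatrix_cyclic (h : IsFockStage q e n l Z Y ι) (p : Submodule K (Fin (e + 1) → U))
    (hι : ∀ u, Pi.single 0 (ι u) ∈ p)
    (hp : ∀ j < l + 1, ∀ x ∈ p, nextMatrix q e l Y 0 j x ∈ p) : p = ⊤ := by
  have ground : p.comap (LinearMap.single K (fun _ => U) 0) = ⊤ := by
    refine h.cyclic _ hι fun j hj x hx => ?_
    have := hp j (by omega) _ hx
    rwa [nextMatrix_of_ne 0 (by omega) (by omega), LinearMap.single_apply, piEnd_single] at this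
  have level : ∀ (r : Fin (e + 1)) (x : U), Pi.single r x ∈ p := by
    intro r
    induction r using Fin.induction with
    | zero => exact fun x => Submodule.mem_comap.1 (ground.symm ▸ Submodule.mem_top)
    | succ r ih =>
      intro x
      obtain ⟨y, rfl⟩ := h.row_bijective.2 x
      have := hp l (by omega) _ (ih y)
      rwa [h.nextMatrix_row_left, Module.End.mul_apply, oscRaise_single_castSucc,
        piEnd_single] at this
  refine eq_top_iff.2 fun g _ => ?_
  rw [← Finset.univ_sum_single g]
  exact Submodule.sum_mem _ fun r _ => level r _

theorem nextMatrix_singular (h : IsFockStage q e n l Z Y ι) (hq0 : q ≠ 0)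
    (hq : ∀ p, 0 < p → p < e + 1 → q ^ (2 * p) ≠ 1) (hl : l < n) (x : Fin (e + 1) → U)
    (w : ℕ → Fin (e + 1) → U)
    (hw : ∀ s < n, nextMatrix q e l Y (s + 1) (l + 1) x +
      ∑ j ∈ Finset.Ico (l + 1) n, nextMatrix q e l Y (s + 1) (j + 1) (w j) = 0) :
    (∃ u, Pi.single 0 (ι u) = x) ∧ ∀ j, l + 1 ≤ j → j < n → w j = 0 := by
  have level : ∀ r : Fin (e + 1), (∃ u, ι u = oscScale q e U x r) ∧
      ∀ j, l ≤ j → j < n → (if j = l then oscLower q e U x r else w j r) = 0 := by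
    intro r
    refine h.singular _ (fun j => if j = l then oscLower q e U x r else w j r) fun s hs => ?_
    have hsr := congr_fun (hw s hs) r
    simp only [nextMatrix_right, Pi.add_apply, Finset.sum_apply, piEnd_apply, Pi.zero_apply] at hsr
    rw [Finset.sum_eq_sum_Ico_succ_bot hl, if_pos rfl, ← add_assoc, ← hsr]
    congr 1
    refine Finset.sum_congr rfl fun j hj => ?_
    have := (Finset.mem_Ico.1 hj).1
    rw [if_neg (by omega), nextMatrix_of_ne _ (by omega) (by omega), piEnd_apply]
  have hlower : oscLower q e U x = 0 := funext fun r => by simpa using (level r).2 l le_rfl hl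
  refine ⟨?_, fun j h1 h2 => funext fun r => ?_⟩
  · obtain ⟨u, hu⟩ := (level 0).1
    refine ⟨u, funext fun r => Fin.cases ?_ (fun r => ?_) r⟩
    · simpa using hu
    · rw [eq_zero_of_oscLower_eq_zero hq0 hq hlower, Pi.single_eq_of_ne (Fin.succ_ne_zero r)]
  · have := (level r).2 j (by omega) h2
    rwa [if_neg (by omega)] at this

theorem next (h : IsFockStage q e n l Z Y ι) (hq0 : q ≠ 0) (hq : q ^ (2 * (e + 1)) = 1)
    (hq' : ∀ p, 0 < p → p < e + 1 → q ^ (2 * p) ≠ 1) (hl : l < n) :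
    IsFockStage q e n (l + 1) Z (nextMatrix q e l Y)
      (LinearMap.single K (fun _ : Fin (e + 1) => U) 0 ∘ₗ ι) where
  rel := h.isQuantumMatrix_nextMatrix hq0 hq
  inj := h.nextMatrix_injective hq0 hq hl
  row_zero j hj := by
    rw [nextMatrix_of_ne 0 (by omega) (by omega), h.row_zero j (by omega), map_zero]
  row_bijective := h.nextMatrix_row_bijective hq0
  row_ι u := by
    rw [LinearMap.comp_apply, LinearMap.single_apply, h.nextMatrix_row_right, Module.End.mul_apply,
      oscScale_single_zero, piEnd_single, h.row_ι]
  row_pow _ hj := h.nextMatrix_row_pow hj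
  ι_injective := (Pi.single_injective 0).comp h.ι_injective
  left s _ hj := h.nextMatrix_apply_left s hj
  middle s u := by
    rw [LinearMap.comp_apply, LinearMap.single_apply, nextMatrix_right, oscScale_single_zero,
      oscLower_single_zero, piEnd_single, h.middle, map_zero, Pi.single_zero, add_zero]
  right s j hj u := by
    rw [LinearMap.comp_apply, LinearMap.single_apply, nextMatrix_of_ne _ (by omega) (by omega),
      piEnd_single, h.right s j (by omega)]
    rfl
  cyclic := h.nextMatrix_cyclic
  finite := by
    have := h.finite
    infer_instance
  finrank := by
    have := h.finite
    rw [Module.finrank_pi_fintype, Finset.sum_const, h.finrank, Finset.card_univ, Fintype.card_fin,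
      smul_eq_mul, pow_succ]
    ring
  singular := h.nextMatrix_singular hq0 hq' hl

theorem left_pow (h : IsFockStage q e n l Z Y ι) (s : ℕ) {j : ℕ} (hj : j < l) (k : ℕ) (u : V) :
    (Y (s + 1) j ^ k) (ι u) = ι ((Z s j ^ k) u) := by
  induction k with
  | zero => rfl
  | succ k ih =>
    rw [pow_succ', Module.End.mul_apply, ih, h.left s j hj, pow_succ', Module.End.mul_apply]

theorem isFockRep {v : V} (h : IsFockStage q e n n Z Y ι) (hZ : IsFockRep q e n Z v) :
    IsFockRep q e (n + 1) Y (ι v) where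
  rel := h.rel
  inj := h.inj
  lower i hi j hj hij := by
    obtain ⟨s, rfl⟩ : ∃ s, i = s + 1 := ⟨i - 1, by omega⟩
    rcases (Nat.lt_succ_iff.1 hj).eq_or_lt with rfl | hj
    · exact h.middle s _
    · rw [h.left s j hj, hZ.lower s (by omega) j hj (by omega), map_zero]
  diag i j hij := by
    rcases i with _ | s
    · obtain rfl : j = n := by omega
      exact h.row_ι _
    · rw [h.left s j (by omega), hZ.diag s j (by omega)]
  upper_pow i j hij := by
    rcases i with _ | s
    · rw [h.row_pow j (by omega), LinearMap.zero_apply]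
    · rw [h.left_pow s (by omega), hZ.upper_pow s j (by omega), map_zero]
  cyclic p hv hp := by
    have hcomap : p.comap ι = ⊤ := by
      refine hZ.cyclic _ hv fun i hi j hj u hu => ?_
      have := hp (i + 1) (by omega) j (by omega) _ hu
      rwa [h.left i j hj] at this
    refine h.cyclic p (fun u => ?_) fun j hj => hp 0 (by omega) j (by omega)
    exact (hcomap ▸ Submodule.mem_top : u ∈ p.comap ι)
  finite := h.finite
  finrank := by rw [h.finrank, hZ.finrank, Finset.sum_range_succ, pow_add, mul_comm]
  singular x hx := by
    obtain ⟨⟨u, rfl⟩, -⟩ := h.singular x (fun _ => 0) fun s hs => by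
      simpa using hx (s + 1) (by omega) n (by omega) (by omega)
    obtain ⟨c, rfl⟩ := hZ.singular u fun i hi j hj hij => h.ι_injective <| by
      rw [← h.left i j hj, hx (i + 1) (by omega) j (by omega) (by omega), map_zero]
    exact ⟨c, map_smul _ _ _⟩

end IsFockStage

end FockRep

theorem IsFockRep.exists_isFockStage {K : Type u} {V : Type u} [Field K] [AddCommGroup V]
    [Module K V] {q : K} {e n : ℕ} {Z : ℕ → ℕ → Module.End K V} {v : V} (h : IsFockRep q e n Z v)
    (hq0 : q ≠ 0) (hq : q ^ (2 * (e + 1)) = 1) (hq' : ∀ p, 0 < p → p < e + 1 → q ^ (2 * p) ≠ 1)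
    (l : ℕ) (hl : l ≤ n) :
    ∃ (U : Type u) (_ : AddCommGroup U) (_ : Module K U) (Y : ℕ → ℕ → Module.End K U)
      (ι : V →ₗ[K] U), IsFockStage q e n l Z Y ι := by
  induction l with
  | zero => exact ⟨V, _, _, _, _, h.isFockStage_oneSum⟩
  | succ l ih =>
    obtain ⟨U, _, _, Y, ι, hY⟩ := ih (by omega)
    exact ⟨_, _, _, _, _, hY.next hq0 hq hq' hl⟩

theorem exists_isFockRep {K : Type u} [Field K] {q : K} {e : ℕ} (hq0 : q ≠ 0)
    (hq : q ^ (2 * (e + 1)) = 1) (hq' : ∀ p, 0 < p → p < e + 1 → q ^ (2 * p) ≠ 1) (n : ℕ) :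
    ∃ (V : Type u) (_ : AddCommGroup V) (_ : Module K V) (Z : ℕ → ℕ → Module.End K V) (v : V),
      IsFockRep q e n Z v := by
  induction n with
  | zero => exact ⟨K, _, _, _, _, isFockRep_zero q e⟩
  | succ n ih =>
    obtain ⟨V, _, _, Z, v, hZ⟩ := ih
    obtain ⟨U, _, _, Y, ι, hY⟩ := hZ.exists_isFockStage hq0 hq hq' n le_rfl
    exact ⟨U, _, _, Y, ι v, hY.isFockRep hZ⟩

section QuantumMatrixPowers

variable {K R ι κ : Type*} [Field K] [Ring R] [Algebra K R] [LinearOrder ι] [LinearOrder κ]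
  {q : K} {Y : ι → κ → R}

theorem IsQuantumMatrix.skewCommute (h : IsQuantumMatrix q Y) (hq : q ≠ 0) {i s : ι} {j t : κ}
    (h1 : ¬ (i < s ∧ j < t)) (h2 : ¬ (s < i ∧ t < j)) : SkewCommute K (Y i j) (Y s t) := by
  rcases lt_trichotomy i s with his | rfl | his <;> rcases lt_trichotomy j t with hjt | rfl | hjt
  · exact absurd ⟨his, hjt⟩ h1
  · exact ⟨q, hq, h.column j i s his⟩
  · exact .of_commute ((h.pair t j hjt).anti i s his)
  · exact ⟨q, hq, (h.pair j t hjt).row i⟩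
  · exact .of_commute (Commute.refl _)
  · exact .symm ⟨q, hq, (h.pair t j hjt).row i⟩
  · exact .of_commute ((h.pair j t hjt).anti s i his).symm
  · exact .symm ⟨q, hq, h.column j s i his⟩
  · exact absurd ⟨his, hjt⟩ h2

theorem pow_mul_eq_of_mul_eq_add {x y z : R} {a p : K} (hxy : x * y = y * x + a • z)
    (hxz : x * z = p • (z * x)) (k : ℕ) :
    x ^ (k + 1) * y = y * x ^ (k + 1) +
      (a * ∑ i ∈ Finset.range (k + 1), p ^ i) • (z * x ^ k) := by
  induction k with
  | zero => simpa using hxy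
  | succ k ih =>
    rw [pow_succ' x (k + 1), mul_assoc, ih, mul_add, ← mul_assoc, hxy, mul_smul_comm,
      ← mul_assoc x z, hxz, add_mul, smul_mul_assoc, smul_mul_assoc, mul_assoc, mul_assoc z,
      ← pow_succ', ← pow_succ', Finset.sum_range_succ' _ (k + 1), add_assoc]
    congr 1
    simp only [pow_succ p, ← Finset.sum_mul]
    module

theorem commute_pow_of_mul_eq_add {x y z : R} {a p : K} (hxy : x * y = y * x + a • z)
    (hxz : x * z = p • (z * x)) {e : ℕ} (hpe : p ^ e = 1) (hp : p ≠ 1) : Commute (x ^ e) y := by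
  cases e with
  | zero => exact pow_zero x ▸ Commute.one_left y
  | succ e =>
    rw [Commute, SemiconjBy, pow_mul_eq_of_mul_eq_add hxy hxz, geom_sum_eq hp, hpe, sub_self,
      zero_div, mul_zero, zero_smul, add_zero]

theorem IsQuantumMatrix.skewCommute_pow (h : IsQuantumMatrix q Y) (hq0 : q ≠ 0) {e : ℕ}
    (hqe : (q ^ 2) ^ e = 1) (hq : q ^ 2 ≠ 1) (i s : ι) (j t : κ) :
    SkewCommute K (Y i j ^ e) (Y s t) := by
  by_cases h1 : i < s ∧ j < t
  · have hz : Y i j * (Y i t * Y s j) = q ^ 2 • (Y i t * Y s j * Y i j) := by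
      rw [← mul_assoc, (h.pair j t h1.2).row, smul_mul_assoc, mul_assoc, h.column j i s h1.1,
        mul_smul_comm, smul_smul, mul_assoc, pow_two]
    exact .of_commute
      (commute_pow_of_mul_eq_add ((h.pair j t h1.2).diag i s h1.1) hz hqe hq)
  by_cases h2 : s < i ∧ t < j
  · have hz : Y i j * (Y s j * Y i t) = (q ^ 2)⁻¹ • (Y s j * Y i t * Y i j) := by
      rw [eq_inv_smul_iff₀ (pow_ne_zero 2 hq0), mul_assoc, (h.pair t j h2.2).row, mul_smul_comm,
        ← mul_assoc, ← mul_assoc, h.column j s i h2.1, smul_mul_assoc, smul_smul, pow_two]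
    have hxy : Y i j * Y s t = Y s t * Y i j + (-(q - q⁻¹)) • (Y s j * Y i t) := by
      rw [(h.pair t j h2.2).diag s i h2.1]
      module
    exact .of_commute (commute_pow_of_mul_eq_add hxy hz (by rw [inv_pow, hqe, inv_one])
      (inv_ne_one.2 hq))
  exact (h.skewCommute hq0 h1 h2).pow_left e

end QuantumMatrixPowers

section TorusRelations

variable {n : ℕ} {q : ℂ}

theorem weightPairing_add (ξ η : WeightLattice n) (α : RootLattice n) :
    weightPairing (ξ + η) α = weightPairing ξ α + weightPairing η α := by
  simp [weightPairing, add_mul, Finset.sum_add_distrib]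

theorem torusL_mul (ξ η : WeightLattice n) :
    torusL n q ξ * torusL n q η = torusL n q (ξ + η) := by
  rw [torusL, torusL, ← map_mul, toTorusMatrixAlgebra_rel (TorusMatrixRel.torusMul ξ η), torusL]

theorem torusL_mul_matZ (ξ : WeightLattice n) (i j : Fin n) :
    torusL n q ξ * matZ n q i j =
      q ^ weightPairing ξ (rootZ i j) • (matZ n q i j * torusL n q ξ) := by
  rw [torusL, matZ, ← map_mul, toTorusMatrixAlgebra_rel (TorusMatrixRel.cross ξ i j), map_smul,
    map_mul]

theorem isQuantumMatrix_matZ : IsQuantumMatrix q (matZ n q) where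
  column j i s his := by
    simp only [matZ, ← map_mul, ← map_smul]
    exact toTorusMatrixAlgebra_rel (TorusMatrixRel.col i j s his)
  pair j t hjt :=
    { row := fun i => by
        simp only [matZ, ← map_mul, ← map_smul]
        exact toTorusMatrixAlgebra_rel (TorusMatrixRel.row i j t hjt)
      anti := fun i s his => by
        simp only [matZ, ← map_mul]
        exact toTorusMatrixAlgebra_rel (TorusMatrixRel.anti i t s j his hjt)
      diag := fun i s his => by
        simp only [matZ, ← map_mul, ← map_smul, ← map_add]
        exact toTorusMatrixAlgebra_rel (TorusMatrixRel.diag i j s t his hjt) }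

theorem skewCommute_torusL_matZ (hq : q ≠ 0) (ξ : WeightLattice n) (i j : Fin n) :
    SkewCommute ℂ (torusL n q ξ) (matZ n q i j) :=
  ⟨_, zpow_ne_zero _ hq, torusL_mul_matZ ξ i j⟩

theorem skewCommute_torusL (ξ η : WeightLattice n) :
    SkewCommute ℂ (torusL n q ξ) (torusL n q η) :=
  .of_commute (by rw [Commute, SemiconjBy, torusL_mul, torusL_mul, add_comm])

variable (w : ModificationDatum n)

theorem modZ_eq (i j : Fin n) :
    modZ q w i j = matZ n q i j * torusL n q (w.ζ i + w.ξ j) := by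
  rw [modZ, mul_assoc, torusL_mul]

theorem modZ_mul_modZ (i j s t : Fin n) :
    modZ q w i j * modZ q w s t = q ^ weightPairing (w.ζ i + w.ξ j) (rootZ s t) •
      (matZ n q i j * matZ n q s t * torusL n q (w.ζ i + w.ξ j + (w.ζ s + w.ξ t))) := by
  rw [modZ_eq, modZ_eq, mul_assoc, ← mul_assoc (torusL n q _), torusL_mul_matZ, smul_mul_assoc,
    mul_assoc (matZ n q s t), torusL_mul, mul_smul_comm, mul_assoc (matZ n q i j)]

variable {w}

theorem SkewCommute.modZ_right {x : TorusMatrixAlgebra n q} {s t : Fin n}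
    (hZ : SkewCommute ℂ x (matZ n q s t)) (hL : ∀ ξ, SkewCommute ℂ x (torusL n q ξ)) :
    SkewCommute ℂ x (modZ q w s t) := by
  rw [modZ_eq]
  exact hZ.mul_right (hL _)

theorem skewCommute_torusL_modZ (hq : q ≠ 0) (ξ : WeightLattice n) (s t : Fin n) :
    SkewCommute ℂ (torusL n q ξ) (modZ q w s t) :=
  (skewCommute_torusL_matZ hq ξ s t).modZ_right (skewCommute_torusL ξ)

theorem skewCommute_modZ (hq : q ≠ 0) {i j s t : Fin n} (h1 : ¬ (i < s ∧ j < t))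
    (h2 : ¬ (s < i ∧ t < j)) : SkewCommute ℂ (modZ q w i j) (modZ q w s t) := by
  rw [modZ_eq]
  exact ((isQuantumMatrix_matZ.skewCommute hq h1 h2).modZ_right fun ξ =>
    (skewCommute_torusL_matZ hq ξ i j).symm).mul_left (skewCommute_torusL_modZ hq _ s t)

theorem exists_modZ_mul_eq_add (hq : q ≠ 0) {i j s t : Fin n} (h1 : s < i) (h2 : t < j) :
    ∃ c d : ℂ, modZ q w i j * modZ q w s t =
      c • (modZ q w s t * modZ q w i j) + d • (modZ q w s j * modZ q w i t) := by
  have h3 := zpow_ne_zero (weightPairing (w.ζ s + w.ξ t) (rootZ i j)) hq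
  have h4 := zpow_ne_zero (weightPairing (w.ζ s + w.ξ j) (rootZ i t)) hq
  refine ⟨q ^ weightPairing (w.ζ i + w.ξ j) (rootZ s t) *
    (q ^ weightPairing (w.ζ s + w.ξ t) (rootZ i j))⁻¹,
    - (q ^ weightPairing (w.ζ i + w.ξ j) (rootZ s t) * (q - q⁻¹)) *
    (q ^ weightPairing (w.ζ s + w.ξ j) (rootZ i t))⁻¹, ?_⟩
  simp only [modZ_mul_modZ, smul_smul]
  rw [inv_mul_cancel_right₀ h3, inv_mul_cancel_right₀ h4,
    (isQuantumMatrix_matZ.pair t j h2).diag s i h1,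
    show w.ζ s + w.ξ j + (w.ζ i + w.ξ t) = w.ζ i + w.ξ j + (w.ζ s + w.ξ t) by abel,
    show w.ζ s + w.ξ t + (w.ζ i + w.ξ j) = w.ζ i + w.ξ j + (w.ζ s + w.ξ t) by abel, add_mul,
    smul_mul_assoc]
  module

theorem skewCommute_modZ_pow (hq0 : q ≠ 0) {e : ℕ} (hqe : (q ^ 2) ^ e = 1) (hq : q ^ 2 ≠ 1)
    (i j s t : Fin n) : SkewCommute ℂ (modZ q w i j ^ e) (modZ q w s t) := by
  have hL := fun ξ => (skewCommute_torusL_matZ hq0 ξ i j).symm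
  have hZ : SkewCommute ℂ (matZ n q i j ^ e) (modZ q w s t) :=
    (isQuantumMatrix_matZ.skewCommute_pow hq0 hqe hq i s j t).modZ_right fun ξ => (hL ξ).pow_left e
  obtain ⟨c, hc⟩ := (hL (w.ζ i + w.ξ j)).exists_mul_pow e
  rw [modZ_eq, hc]
  exact (hZ.mul_left ((skewCommute_torusL_modZ hq0 _ s t).pow_left e)).smul_left c

/-- The generators of the modified algebra, with the columns in reversed order: the generators with
`i + j ≤ n` in one-based indices become the entries above the diagonal, those on the antidiagonal
become the diagonal. -/
noncomputable def revGen (q : ℂ) (w : ModificationDatum n) (i j : Fin n) : modifiedAlgebra q w :=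
  modGen q w i j.rev

theorem SkewCommute.of_coe {x y : modifiedAlgebra q w}
    (h : SkewCommute ℂ (x : TorusMatrixAlgebra n q) y) : SkewCommute ℂ x y := by
  obtain ⟨c, hc0, hc⟩ := h
  exact ⟨c, hc0, Subtype.ext hc⟩

theorem straightening_revGen (hq : q ≠ 0) : Straightening ℂ (revGen q w) where
  skew i j a b h1 h2 := .of_coe (skewCommute_modZ hq (i := i) (j := j.rev) (s := a) (t := b.rev)
    (by simpa using h1) (by simpa using h2))
  cross i j a b h1 h2 := by
    obtain ⟨c, d, hc⟩ := exists_modZ_mul_eq_add (w := w) hq h1 (Fin.rev_lt_rev.2 h2)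
    exact ⟨c, d, Subtype.ext hc⟩

theorem skewCommute_revGen_pow (hq0 : q ≠ 0) {e : ℕ} (hqe : (q ^ 2) ^ e = 1) (hq : q ^ 2 ≠ 1)
    (i j s t : Fin n) : SkewCommute ℂ (revGen q w i j ^ e) (revGen q w s t) :=
  .of_coe (skewCommute_modZ_pow hq0 hqe hq i j.rev s t.rev)

theorem modGen_eq_revGen (i j : Fin n) : modGen q w i j = revGen q w i j.rev := by
  rw [revGen, Fin.rev_rev]

theorem adjoin_revGen :
    Algebra.adjoin ℂ {x : modifiedAlgebra q w | ∃ i j, x = revGen q w i j} = ⊤ := by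
  have hset : {x : modifiedAlgebra q w | ∃ i j, x = revGen q w i j} =
      Subtype.val ⁻¹' {x | ∃ i j : Fin n, x = modZ q w i j} := by
    ext x
    constructor
    · rintro ⟨i, j, rfl⟩
      exact ⟨i, j.rev, rfl⟩
    · rintro ⟨i, j, hx⟩
      exact ⟨i, j.rev, Subtype.ext (by rw [hx, ← modGen_eq_revGen]; rfl)⟩
  rw [hset]
  exact Algebra.adjoin_adjoin_coe_preimage

theorem apply_mem_of_forall_revGen {M : Type*} [AddCommGroup M] [Module ℂ M]
    (ρ : modifiedAlgebra q w →ₐ[ℂ] Module.End ℂ M) {T : Submodule ℂ M}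
    (hT : ∀ i j, ∀ u ∈ T, ρ (revGen q w i j) u ∈ T) (y : modifiedAlgebra q w) {u : M}
    (hu : u ∈ T) : ρ y u ∈ T := by
  suffices h : ∀ u ∈ T, ρ y u ∈ T from h u hu
  have hy : y ∈ Algebra.adjoin ℂ {x : modifiedAlgebra q w | ∃ i j, x = revGen q w i j} :=
    adjoin_revGen ▸ Algebra.mem_top
  induction hy using Algebra.adjoin_induction with
  | mem x hx =>
    obtain ⟨i, j, rfl⟩ := hx
    exact hT i j
  | algebraMap r =>
    exact fun u hu => by simpa [Algebra.algebraMap_eq_smul_one] using T.smul_mem r hu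
  | add x y _ _ hx hy => exact fun u hu => by simpa using add_mem (hx u hu) (hy u hu)
  | mul x y _ _ hx hy => exact fun u hu => by simpa using hx _ (hy u hu)

end TorusRelations

section FunctionModule

variable {n : ℕ} {q : ℂ} {V : Type*} [AddCommGroup V] [Module ℂ V]

theorem exists_zpow_weightPairing_rootZ_eq (hq : q ≠ 0) (η : WeightLattice n) :
    ∃ r c : Fin n → ℂ, ∀ i j, q ^ weightPairing η (rootZ i j) = r i * c j := by
  refine ⟨fun i => q ^ (η (.inl ()) + ∑ a : Fin (n - 1), if (a : ℕ) < i then η (.inr (.inl a))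
    else 0), fun j => q ^ ∑ b : Fin (n - 1), if (b : ℕ) < j then η (.inr (.inr b)) else 0,
    fun i j => ?_⟩
  rw [← zpow_add₀ hq]
  simp [weightPairing, rootZ, add_assoc]

theorem IsQuantumMatrix.zpow_weightPairing_smul {Y : Fin n → Fin n → Module.End ℂ V}
    (hY : IsQuantumMatrix q Y) (hq : q ≠ 0) (η : WeightLattice n) :
    IsQuantumMatrix q fun i j => q ^ weightPairing η (rootZ i j) • Y i j := by
  obtain ⟨r, c, hrc⟩ := exists_zpow_weightPairing_rootZ_eq hq η
  simp only [hrc]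
  exact hY.smul r c

/-- The action of `Z_{i,j}` on functions on the weight lattice with values in a module over the
quantized matrix algebra. The factor `q ^ (η | α_{i,j})` produces the relation with the torus, which
acts by translation. -/
noncomputable def latticeZ (q : ℂ) (Y : Fin n → Fin n → Module.End ℂ V) (i j : Fin n) :
    Module.End ℂ (WeightLattice n → V) :=
  LinearMap.pi fun η => (q ^ weightPairing η (rootZ i j) • Y i j) ∘ₗ LinearMap.proj η

theorem isQuantumMatrix_latticeZ (hq : q ≠ 0) {Y : Fin n → Fin n → Module.End ℂ V}
    (hY : IsQuantumMatrix q Y) : IsQuantumMatrix q (latticeZ q Y) where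
  column j i s his := LinearMap.ext fun h => funext fun η =>
    LinearMap.congr_fun ((hY.zpow_weightPairing_smul hq η).column j i s his) (h η)
  pair j t hjt :=
    have hpair η := (hY.zpow_weightPairing_smul hq η).pair j t hjt
    { row := fun i => LinearMap.ext fun h => funext fun η =>
        LinearMap.congr_fun ((hpair η).row i) (h η)
      anti := fun i s his => LinearMap.ext fun h => funext fun η =>
        LinearMap.congr_fun ((hpair η).anti i s his) (h η)
      diag := fun i s his => LinearMap.ext fun h => funext fun η =>
        LinearMap.congr_fun ((hpair η).diag i s his) (h η) }

/-- The action of the generators of the semidirect product on functions on the weight lattice: the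
`Z_{i,j}` act by `latticeZ`, and `L_ξ` by translation. -/
noncomputable def torusRepGen (q : ℂ) (Y : Fin n → Fin n → Module.End ℂ V) :
    TorusMatrixGen n → Module.End ℂ (WeightLattice n → V)
  | .Z i j => latticeZ q Y i j
  | .L ξ => LinearMap.funLeft ℂ V (· + ξ)

theorem lift_torusRepGen_rel (hq : q ≠ 0) {Y : Fin n → Fin n → Module.End ℂ V}
    (hY : IsQuantumMatrix q Y) {x y : FreeAlgebra ℂ (TorusMatrixGen n)}
    (hxy : TorusMatrixRel n q x y) :
    FreeAlgebra.lift ℂ (torusRepGen q Y) x = FreeAlgebra.lift ℂ (torusRepGen q Y) y := by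
  have hZ := isQuantumMatrix_latticeZ hq hY
  induction hxy with
  | row i j k hjk => simpa [freeZ, torusRepGen] using (hZ.pair j k hjk).row i
  | col i j k hik => simpa [freeZ, torusRepGen] using hZ.column j i k hik
  | anti i j s t his htj => simpa [freeZ, torusRepGen] using (hZ.pair t j htj).anti i s his
  | diag i j s t his hjt => simpa [freeZ, torusRepGen] using (hZ.pair j t hjt).diag i s his
  | torusOne =>
    ext h η
    simp [freeL, torusRepGen, LinearMap.funLeft_apply]
  | torusMul ξ η =>
    ext h η
    simp [freeL, torusRepGen, LinearMap.funLeft_apply, add_assoc]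
  | cross ξ i j =>
    refine LinearMap.ext fun h => funext fun η => ?_
    simp [freeL, freeZ, torusRepGen, latticeZ, LinearMap.funLeft_apply, weightPairing_add,
      zpow_add₀ hq, smul_smul, mul_comm]

/-- The representation of the semidirect product with the torus on functions on the weight lattice
with values in a module over the quantized matrix algebra. -/
noncomputable def torusRep (hq : q ≠ 0) {Y : Fin n → Fin n → Module.End ℂ V}
    (hY : IsQuantumMatrix q Y) :
    TorusMatrixAlgebra n q →ₐ[ℂ] Module.End ℂ (WeightLattice n → V) :=
  RingQuot.liftAlgHom ℂ
    ⟨FreeAlgebra.lift ℂ (torusRepGen q Y), fun _ _ => lift_torusRepGen_rel hq hY⟩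

variable (hq : q ≠ 0) {Y : Fin n → Fin n → Module.End ℂ V} (hY : IsQuantumMatrix q Y)

theorem torusRep_matZ (i j : Fin n) : torusRep hq hY (matZ n q i j) = latticeZ q Y i j :=
  (RingQuot.liftAlgHom_mkAlgHom_apply ℂ _ _ _).trans (FreeAlgebra.lift_ι_apply _ _)

theorem torusRep_torusL (ξ : WeightLattice n) :
    torusRep hq hY (torusL n q ξ) = LinearMap.funLeft ℂ V (· + ξ) :=
  (RingQuot.liftAlgHom_mkAlgHom_apply ℂ _ _ _).trans (FreeAlgebra.lift_ι_apply _ _)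

/-- The representation of the modified algebra on functions on the weight lattice. -/
noncomputable def modRep (w : ModificationDatum n) :
    modifiedAlgebra q w →ₐ[ℂ] Module.End ℂ (WeightLattice n → V) :=
  (torusRep hq hY).comp (modifiedAlgebra q w).val

variable {w : ModificationDatum n}

theorem modRep_revGen (i j : Fin n) (h : WeightLattice n → V) (η : WeightLattice n) :
    modRep hq hY w (revGen q w i j) h η =
      q ^ weightPairing η (rootZ i j.rev) • Y i j.rev (h (η + (w.ζ i + w.ξ j.rev))) := by
  change torusRep hq hY (modZ q w i j.rev) h η = _
  rw [modZ_eq, map_mul, torusRep_matZ, torusRep_torusL]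
  rfl

/-- The weighted shift by which `revGen q w i j` acts on the coefficient `f` of `f • u`, for a
scalar function `f` on the weight lattice and a constant vector `u`. -/
noncomputable def weightedShift (q : ℂ) (w : ModificationDatum n) (i j : Fin n) :
    Module.End ℂ (WeightLattice n → ℂ) where
  toFun f η := q ^ weightPairing η (rootZ i j.rev) * f (η + (w.ζ i + w.ξ j.rev))
  map_add' f g := funext fun η => by simp [mul_add]
  map_smul' c f := funext fun η => by simp [mul_left_comm]

theorem weightedShift_apply (i j : Fin n) (f : WeightLattice n → ℂ) (η : WeightLattice n) :
    weightedShift q w i j f η =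
      q ^ weightPairing η (rootZ i j.rev) * f (η + (w.ζ i + w.ξ j.rev)) := rfl

include hq in
theorem weightedShift_ne_zero (i j : Fin n) {f : WeightLattice n → ℂ} (hf : f ≠ 0) :
    weightedShift q w i j f ≠ 0 := by
  contrapose! hf
  funext η
  simpa [weightedShift_apply, zpow_ne_zero _ hq] using congr_fun hf (η - (w.ζ i + w.ξ j.rev))

theorem modRep_revGen_smul (i j : Fin n) (f : WeightLattice n → ℂ) (u : V) :
    modRep hq hY w (revGen q w i j) (fun η => f η • u) =
      fun η => weightedShift q w i j f η • Y i j.rev u := by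
  funext η
  rw [modRep_revGen, map_smul, smul_smul, weightedShift_apply]

theorem modRep_revGen_pow_smul (i j : Fin n) (k : ℕ) (f : WeightLattice n → ℂ) (u : V) :
    modRep hq hY w (revGen q w i j ^ k) (fun η => f η • u) =
      fun η => (weightedShift q w i j ^ k) f η • (Y i j.rev ^ k) u := by
  induction k with
  | zero => simp
  | succ k ih =>
    simp only [pow_succ', map_mul, Module.End.mul_apply, ih, modRep_revGen_smul]

theorem finrank_le_finrank_of_span_eq_top {ι K V : Type*} [Field K] [AddCommGroup V] [Module K V]
    (R : Submodule K (ι → V)) [FiniteDimensional K R]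
    (hR : Submodule.span K {u | ∃ g : ι → K, g ≠ 0 ∧ (fun η => g η • u) ∈ R} = ⊤) :
    Module.finrank K V ≤ Module.finrank K R := by
  obtain ⟨b, hbR, hspan, hind⟩ :=
    exists_linearIndependent K {u | ∃ g : ι → K, g ≠ 0 ∧ (fun η => g η • u) ∈ R}
  let B := Module.Basis.mk hind (by rw [Subtype.range_coe, hspan, hR])
  choose g hg hgR using fun x : b => hbR x.2
  have hindR : LinearIndependent K fun x : b => (⟨_, hgR x⟩ : R) := by
    refine linearIndependent_iff'.2 fun t a ha x hx => ?_
    obtain ⟨η, hη⟩ := Function.ne_iff.1 (hg x)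
    have hsum : ∑ y ∈ t, (a y * g y η) • (y : V) = 0 := by
      simpa [Finset.sum_apply, smul_smul] using congr_fun (congrArg Subtype.val ha) η
    exact (mul_eq_zero.1 (linearIndependent_iff'.1 hind t _ hsum x hx)).resolve_right hη
  have := hindR.finite
  rw [Module.finrank_eq_nat_card_basis B]
  have := Fintype.ofFinite b
  simpa using hindR.fintype_card_le_finrank

theorem finrank_le_finrank_of_modRep_stable {v : V}
    (hv : ∀ p : Submodule ℂ V, v ∈ p → (∀ i j, ∀ u ∈ p, Y i j u ∈ p) → p = ⊤)
    {f : WeightLattice n → ℂ} (hf : f ≠ 0) (R : Submodule ℂ (WeightLattice n → V))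
    [FiniteDimensional ℂ R] (hfR : (fun η => f η • v) ∈ R)
    (hR : ∀ i j, ∀ u ∈ R, modRep hq hY w (revGen q w i j) u ∈ R) :
    Module.finrank ℂ V ≤ Module.finrank ℂ R := by
  refine finrank_le_finrank_of_span_eq_top R (hv _ (Submodule.subset_span ⟨f, hf, hfR⟩) ?_)
  intro i j
  suffices h : _ ≤ (Submodule.span ℂ _).comap (Y i j) from h
  refine Submodule.span_le.2 ?_
  rintro u ⟨g, hg, hgu⟩
  have hmem := hR i j.rev _ hgu
  rw [modRep_revGen_smul, Fin.rev_rev] at hmem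
  exact Submodule.subset_span ⟨_, weightedShift_ne_zero hq i j.rev hg, hmem⟩

end FunctionModule

theorem exists_common_eigenvector {K E κ : Type*} [Field K] [IsAlgClosed K] [AddCommGroup E]
    [Module K E] [FiniteDimensional K E] [Nontrivial E] {T : κ → Module.End K E}
    (hT : ∀ k l, Commute (T k) (T l)) : ∃ u : E, u ≠ 0 ∧ ∃ c : κ → K, ∀ k, T k u = c k • u := by
  obtain ⟨p, ⟨hp0, hpT⟩, hmin⟩ := exists_minimal_of_wellFoundedLT
    (fun p : Submodule K E => p ≠ ⊥ ∧ ∀ k, ∀ u ∈ p, T k u ∈ p) ⟨⊤, top_ne_bot, by simp⟩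
  have heig : ∀ k, ∃ c : K, p ≤ Module.End.eigenspace (T k) c := by
    intro k
    have := Submodule.nontrivial_iff_ne_bot.2 hp0
    obtain ⟨c, hc⟩ := Module.End.exists_eigenvalue ((T k).restrict (hpT k))
    obtain ⟨⟨u, hu⟩, huc⟩ := hc.exists_hasEigenvector
    have huT : u ∈ Module.End.eigenspace (T k) c :=
      Module.End.mem_eigenspace_iff.2 (congrArg Subtype.val huc.apply_eq_smul)
    refine ⟨c, le_trans (hmin (y := p ⊓ Module.End.eigenspace (T k) c) ⟨?_, ?_⟩ inf_le_left)
      inf_le_right⟩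
    · exact (Submodule.ne_bot_iff _).2 ⟨u, ⟨hu, huT⟩, fun h => huc.2 (Subtype.ext h)⟩
    · exact fun l x hx => ⟨hpT l x hx.1,
        Module.End.mapsTo_genEigenspace_of_comm (hT k l) c 1 hx.2⟩
  choose c hc using heig
  obtain ⟨u, hu, hu0⟩ := (Submodule.ne_bot_iff p).1 hp0
  exact ⟨u, hu0, c, fun k => Module.End.mem_eigenspace_iff.1 (hc k hu)⟩

section PeriodicFunctions

variable {n m : ℕ} {q : ℂ} {w : ModificationDatum n}

theorem zpow_weightPairing_congr (hq0 : q ≠ 0) (hq : q ^ m = 1) {η η' : WeightLattice n}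
    (h : ∀ k, (η k : ZMod m) = η' k) (α : RootLattice n) :
    q ^ weightPairing η α = q ^ weightPairing η' α := by
  have hdvd : (m : ℤ) ∣ weightPairing η α - weightPairing η' α := by
    simp only [weightPairing, ← Finset.sum_sub_distrib, ← sub_mul]
    refine Finset.dvd_sum fun k _ => Dvd.dvd.mul_right ?_ _
    rw [← ZMod.intCast_zmod_eq_zero_iff_dvd]
    simp [h k]
  obtain ⟨t, ht⟩ := hdvd
  rw [sub_eq_iff_eq_add.1 ht, zpow_add₀ hq0, zpow_mul, zpow_natCast, hq, one_zpow, one_mul]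

/-- The functions on the weight lattice which are periodic modulo `m` in each coordinate. -/
noncomputable def periodicFunctions (n m : ℕ) : Submodule ℂ (WeightLattice n → ℂ) :=
  LinearMap.range (LinearMap.funLeft ℂ ℂ fun (η : WeightLattice n) k => (η k : ZMod m))

theorem mem_periodicFunctions {f : WeightLattice n → ℂ} :
    f ∈ periodicFunctions n m ↔
      ∀ η η' : WeightLattice n, (∀ k, (η k : ZMod m) = η' k) → f η = f η' := by
  constructor
  · rintro ⟨g, rfl⟩ η η' h
    exact congrArg g (funext h)
  · intro h
    refine ⟨fun t => f fun k => (t k).cast, funext fun η => h _ _ fun k => ?_⟩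
    exact ZMod.intCast_zmod_cast _

theorem weightedShift_mem_periodicFunctions (hq0 : q ≠ 0) (hq : q ^ m = 1) (i j : Fin n)
    {f : WeightLattice n → ℂ} (hf : f ∈ periodicFunctions n m) :
    weightedShift q w i j f ∈ periodicFunctions n m := by
  rw [mem_periodicFunctions] at hf ⊢
  intro η η' h
  rw [weightedShift_apply, weightedShift_apply, zpow_weightPairing_congr hq0 hq h,
    hf _ (η' + (w.ζ i + w.ξ j.rev)) fun k => by simp [h k]]

theorem exists_weightedShift_eigenfunction (hm : m ≠ 0) (hq : q ^ m = 1)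
    (hw : ∀ k l, Commute (weightedShift q w k k) (weightedShift q w l l)) :
    ∃ f : WeightLattice n → ℂ, f ≠ 0 ∧ ∃ c : Fin n → ℂ, (∀ k, c k ≠ 0) ∧
      ∀ k, weightedShift q w k k f = c k • f := by
  have hq0 : q ≠ 0 := fun h => one_ne_zero (by rw [← hq, h, zero_pow hm])
  have : NeZero m := ⟨hm⟩
  have : FiniteDimensional ℂ (periodicFunctions n m) := by
    unfold periodicFunctions
    infer_instance
  have : Nontrivial (periodicFunctions n m) :=
    ⟨⟨1, mem_periodicFunctions.2 fun _ _ _ => rfl⟩, 0, fun h =>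
      one_ne_zero (congrArg Subtype.val h)⟩
  let T (k : Fin n) : Module.End ℂ (periodicFunctions n m) :=
    (weightedShift q w k k).restrict fun _ => weightedShift_mem_periodicFunctions hq0 hq k k
  have hT : ∀ k l, Commute (T k) (T l) := fun k l =>
    LinearMap.ext fun f => Subtype.ext (LinearMap.congr_fun (hw k l) f)
  obtain ⟨f, hf, c, hc⟩ := exists_common_eigenvector hT
  have hf' : (f : WeightLattice n → ℂ) ≠ 0 := fun h => hf (Subtype.ext h)
  have hfc : ∀ k, weightedShift q w k k f = c k • (f : WeightLattice n → ℂ) := fun k =>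
    congrArg Subtype.val (hc k)
  refine ⟨f, hf', c, fun k hk => weightedShift_ne_zero (w := w) hq0 k k hf' ?_, hfc⟩
  rw [hfc k, hk, zero_smul]

end PeriodicFunctions

section HighestWeight

variable {n m : ℕ} {q : ℂ} {w : ModificationDatum n} {Λ : Fin n → ℂ} {M : Type*} [AddCommGroup M]
  [Module ℂ M] {ρ : modifiedAlgebra q w →ₐ[ℂ] Module.End ℂ M} {u : M}

/-- A vector annihilated by the generators of the left ideal `I(Λ)`. -/
structure IsHighestWeightVector (m : ℕ) (Λ : Fin n → ℂ)
    (ρ : modifiedAlgebra q w →ₐ[ℂ] Module.End ℂ M) (u : M) : Prop where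
  lower : ∀ i j, j < i → ρ (revGen q w i j) u = 0
  diag : ∀ k, ρ (revGen q w k k) u = Λ k • u
  upper_pow : ∀ i j, i < j → ρ (revGen q w i j ^ reducedOrder m) u = 0

theorem isHighestWeightVector_iff :
    IsHighestWeightVector m Λ ρ u ↔ ∀ y ∈ restrictedIdeal m q w Λ, ρ y u = 0 := by
  constructor
  · intro h y hy
    induction hy using Submodule.span_induction with
    | mem x hx =>
      obtain ⟨⟨i, j, hij, rfl⟩ | ⟨k, rfl⟩⟩ | ⟨i, j, hij, rfl⟩ := hx
      · rw [modGen_eq_revGen]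
        exact h.lower i j.rev (by rw [Fin.lt_def, Fin.val_rev]; omega)
      · rw [modGen_eq_revGen, Fin.rev_rev, map_sub, LinearMap.sub_apply, h.diag k,
          AlgHom.commutes, Module.algebraMap_end_apply, sub_self]
      · rw [modGen_eq_revGen]
        exact h.upper_pow i j.rev (by rw [Fin.lt_def, Fin.val_rev]; omega)
    | zero => rw [map_zero, LinearMap.zero_apply]
    | add x y _ _ hx hy => rw [map_add, LinearMap.add_apply, hx, hy, add_zero]
    | smul a x _ hx => rw [smul_eq_mul, map_mul, Module.End.mul_apply, hx, map_zero]
  · intro h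
    refine ⟨fun i j hji => h _ (Submodule.subset_span (.inl (.inl ⟨i, j.rev, ?_, rfl⟩))),
      fun k => sub_eq_zero.1 ?_,
      fun i j hij => h _ (Submodule.subset_span (.inr ⟨i, j.rev, ?_, rfl⟩))⟩
    · rw [Fin.val_rev]
      omega
    · simpa [revGen] using h _ (Submodule.subset_span (.inl (.inr ⟨k, rfl⟩)))
    · rw [Fin.val_rev]
      omega

theorem revGen_pow_apply_revGen_eq_zero (hq0 : q ≠ 0) {e : ℕ} (hqe : (q ^ 2) ^ e = 1)
    (hq : q ^ 2 ≠ 1) (i j s t : Fin n) (hu : ρ (revGen q w i j ^ e) u = 0) :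
    ρ (revGen q w i j ^ e) (ρ (revGen q w s t) u) = 0 := by
  obtain ⟨c, hc⟩ := ((skewCommute_revGen_pow hq0 hqe hq i j s t).map ρ).exists_apply
  rw [hc, hu, map_zero, smul_zero]

variable (m q w Λ)

/-- The action of the modified algebra on the restricted Verma module by `ℂ`-linear maps. -/
noncomputable abbrev vermaRep :
    modifiedAlgebra q w →ₐ[ℂ] Module.End ℂ (RestrictedVerma m q w Λ) :=
  Algebra.lsmul ℂ ℂ (RestrictedVerma m q w Λ)

/-- The generator of the restricted Verma module. -/
noncomputable def vermaVector : RestrictedVerma m q w Λ :=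
  (restrictedIdeal m q w Λ).mkQ 1

variable {m q w Λ}

theorem smul_vermaVector (y : modifiedAlgebra q w) :
    y • vermaVector m q w Λ = (restrictedIdeal m q w Λ).mkQ y := by
  rw [vermaVector, ← map_smul, smul_eq_mul, mul_one]

theorem exists_smul_vermaVector_eq (x : RestrictedVerma m q w Λ) :
    ∃ y : modifiedAlgebra q w, y • vermaVector m q w Λ = x :=
  (Submodule.mkQ_surjective _ x).imp fun y hy => (smul_vermaVector y).trans hy

theorem isHighestWeightVector_vermaVector :
    IsHighestWeightVector m Λ (vermaRep m q w Λ) (vermaVector m q w Λ) :=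
  isHighestWeightVector_iff.2 fun y hy =>
    (smul_vermaVector y).trans ((Submodule.Quotient.mk_eq_zero _).2 hy)

theorem eq_top_of_vermaVector_mem {T : Submodule ℂ (RestrictedVerma m q w Λ)}
    (hT : ∀ i j, ∀ u ∈ T, revGen q w i j • u ∈ T) (hmem : vermaVector m q w Λ ∈ T) : T = ⊤ := by
  refine eq_top_iff.2 fun x _ => ?_
  obtain ⟨y, rfl⟩ := exists_smul_vermaVector_eq x
  exact apply_mem_of_forall_revGen (vermaRep m q w Λ) hT y hmem

theorem straightening_vermaRep (hq : q ≠ 0) :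
    Straightening ℂ fun i j => vermaRep m q w Λ (revGen q w i j) :=
  (straightening_revGen hq).map _

theorem vermaRep_revGen_pow_eq_zero (hr : 0 < reducedOrder m) (hq0 : q ≠ 0)
    (hqr : (q ^ 2) ^ reducedOrder m = 1) (hq : q ^ 2 ≠ 1) {i j : Fin n} (hij : i ≠ j) :
    vermaRep m q w Λ (revGen q w i j) ^ reducedOrder m = 0 := by
  have hvec := isHighestWeightVector_vermaVector (m := m) (q := q) (w := w) (Λ := Λ)
  have hpow : vermaRep m q w Λ (revGen q w i j ^ reducedOrder m) (vermaVector m q w Λ) = 0 := by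
    rcases hij.lt_or_gt with h | h
    · exact hvec.upper_pow i j h
    · obtain ⟨k, hk⟩ := Nat.exists_eq_add_of_lt hr
      rw [hk, pow_succ, map_mul, Module.End.mul_apply, hvec.lower i j h, map_zero]
  rw [← map_pow]
  exact LinearMap.ker_eq_top.1 (eq_top_of_vermaVector_mem
    (fun a b u hu => revGen_pow_apply_revGen_eq_zero hq0 hqr hq i j a b hu) hpow)

theorem finrank_restrictedVerma_le (hr : 0 < reducedOrder m) (hq0 : q ≠ 0)
    (hqr : (q ^ 2) ^ reducedOrder m = 1) (hq : q ^ 2 ≠ 1) :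
    FiniteDimensional ℂ (RestrictedVerma m q w Λ) ∧
      Module.finrank ℂ (RestrictedVerma m q w Λ) ≤ reducedOrder m ^ ∑ i ∈ Finset.range n, i := by
  have hvec := isHighestWeightVector_vermaVector (m := m) (q := q) (w := w) (Λ := Λ)
  have htop : Straightening.upperClosure (fun i j => vermaRep m q w Λ (revGen q w i j))
      (vermaVector m q w Λ) n = ⊤ :=
    eq_top_of_vermaVector_mem (fun i j u hu => (straightening_vermaRep hq0).apply_mem_upperClosure
      hvec.lower (fun k => ⟨_, hvec.diag k⟩) i j hu) (Straightening.mem_upperClosure le_rfl)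
  have hrank := (straightening_vermaRep hq0).finrank_upperClosure_le (s := vermaVector m q w Λ) hr
    (fun i j hij => vermaRep_revGen_pow_eq_zero hr hq0 hqr hq hij.ne) le_rfl
  rw [htop, finrank_top] at hrank
  exact ⟨Module.finite_def.2 (Module.Finite.iff_fg.1 hrank.1), hrank.2⟩

/-- The linear map from the restricted Verma module determined by a highest weight vector. -/
noncomputable def IsHighestWeightVector.lift (h : IsHighestWeightVector m Λ ρ u) :
    RestrictedVerma m q w Λ →ₗ[ℂ] M :=
  ((restrictedIdeal m q w Λ).restrictScalars ℂ).liftQ (LinearMap.applyₗ u ∘ₗ ρ.toLinearMap)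
    (isHighestWeightVector_iff.1 h) ∘ₗ
  (Submodule.Quotient.restrictScalarsEquiv ℂ (restrictedIdeal m q w Λ)).symm

theorem IsHighestWeightVector.lift_smul_vermaVector (h : IsHighestWeightVector m Λ ρ u)
    (y : modifiedAlgebra q w) : h.lift (y • vermaVector m q w Λ) = ρ y u := by
  rw [smul_vermaVector]
  rfl

theorem IsHighestWeightVector.lift_smul (h : IsHighestWeightVector m Λ ρ u)
    (y : modifiedAlgebra q w) (x : RestrictedVerma m q w Λ) :
    h.lift (y • x) = ρ y (h.lift x) := by
  obtain ⟨z, rfl⟩ := exists_smul_vermaVector_eq x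
  rw [← mul_smul, h.lift_smul_vermaVector, h.lift_smul_vermaVector, map_mul, Module.End.mul_apply]

theorem IsHighestWeightVector.lift_vermaVector (h : IsHighestWeightVector m Λ ρ u) :
    h.lift (vermaVector m q w Λ) = u := by
  rw [← one_smul (modifiedAlgebra q w) (vermaVector m q w Λ), h.lift_smul_vermaVector, map_one,
    Module.End.one_apply]

theorem IsHighestWeightVector.vermaVector_ne_zero (h : IsHighestWeightVector m Λ ρ u)
    (hu : u ≠ 0) : vermaVector m q w Λ ≠ 0 := by
  rw [← h.lift_vermaVector] at hu
  exact fun h0 => hu (by rw [h0, map_zero])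

end HighestWeight

section FockFunctions

variable {n e : ℕ} {q : ℂ} {V : Type*} [AddCommGroup V] [Module ℂ V]
  {Z : ℕ → ℕ → Module.End ℂ V} {v : V}

/-- The matrix `Z` of size `n` with its rows scaled by `r` and its columns, counted from the right,
scaled by `c`, so that the scalars on the antidiagonal are `r k * c k`. -/
def scaledMatrix (Z : ℕ → ℕ → Module.End ℂ V) (r c : Fin n → ℂ) (i j : Fin n) : Module.End ℂ V :=
  (r i * c j.rev) • Z i j

theorem IsQuantumMatrix.scaledMatrix (h : IsQuantumMatrix q Z) (r c : Fin n → ℂ) :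
    IsQuantumMatrix q (scaledMatrix Z r c) :=
  (h.reindex Fin.val_strictMono Fin.val_strictMono).smul r fun j => c j.rev

/-- The representation of the modified algebra on functions on the weight lattice with values in the
Fock representation, twisted by row and column scalars. -/
noncomputable abbrev fockRep (hq : q ≠ 0) (H : IsFockRep q e n Z v) (r c : Fin n → ℂ)
    (w : ModificationDatum n) : modifiedAlgebra q w →ₐ[ℂ] Module.End ℂ (WeightLattice n → V) :=
  modRep hq (H.rel.scaledMatrix r c) w

variable (hq : q ≠ 0) (H : IsFockRep q e n Z v) {w : ModificationDatum n} {r c : Fin n → ℂ}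

theorem fockRep_revGen_smul (i j : Fin n) (f : WeightLattice n → ℂ) (u : V) :
    fockRep hq H r c w (revGen q w i j) (fun η => f η • u) =
      fun η => (r i * c j * weightedShift q w i j f η) • Z i j.rev u := by
  rw [modRep_revGen_smul, scaledMatrix, Fin.rev_rev]
  exact funext fun η => by rw [LinearMap.smul_apply, smul_smul, mul_comm]

theorem fockRep_revGen_self_smul_vacuum (k : Fin n) (f : WeightLattice n → ℂ) :
    fockRep hq H r c w (revGen q w k k) (fun η => f η • v) =
      fun η => (r k * c k * weightedShift q w k k f η) • v := by
  rw [fockRep_revGen_smul, H.diag k k.rev (by rw [Fin.val_rev]; omega)]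

theorem isHighestWeightVector_smul_vacuum {m : ℕ} (hm : reducedOrder m = e + 1)
    {f : WeightLattice n → ℂ} {s Λ : Fin n → ℂ} (hf : ∀ k, weightedShift q w k k f = s k • f)
    (hΛ : ∀ k, r k * c k * s k = Λ k) :
    IsHighestWeightVector m Λ (fockRep hq H r c w) (fun η => f η • v) where
  lower i j hji := by
    rw [fockRep_revGen_smul, H.lower i i.2 j.rev j.rev.2 (by rw [Fin.val_rev]; omega)]
    exact funext fun _ => smul_zero _
  diag k := by
    rw [fockRep_revGen_self_smul_vacuum, hf]
    exact funext fun η => by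
      rw [Pi.smul_apply, Pi.smul_apply, smul_eq_mul, ← mul_assoc, hΛ, mul_smul]
  upper_pow i j hij := by
    rw [modRep_revGen_pow_smul, scaledMatrix, smul_pow, LinearMap.smul_apply, hm,
      H.upper_pow i j.rev (by rw [Fin.val_rev]; omega), smul_zero]
    exact funext fun _ => smul_zero _

theorem exists_eq_smul_vacuum (hr : ∀ k, r k ≠ 0) (hc : ∀ k, c k ≠ 0) {x : WeightLattice n → V}
    (hx : ∀ i j, j < i → fockRep hq H r c w (revGen q w i j) x = 0) :
    ∃ g : WeightLattice n → ℂ, x = fun η => g η • v := by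
  suffices h : ∀ η, ∃ a : ℂ, x η = a • v by
    choose g hg using h
    exact ⟨g, funext hg⟩
  refine fun η => H.singular _ fun i hi j hj hij => ?_
  have hzero := congr_fun (hx ⟨i, hi⟩ (Fin.rev ⟨j, hj⟩) (by
    rw [Fin.lt_def, Fin.val_rev, Fin.val_mk, Fin.val_mk]
    omega)) (η - (w.ζ ⟨i, hi⟩ + w.ξ ⟨j, hj⟩))
  simpa [modRep_revGen, scaledMatrix, zpow_ne_zero _ hq, hr, hc] using hzero

include hq H in
theorem commute_weightedShift (hw : AntidiagonalCommutes q w) (k l : Fin n) :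
    Commute (weightedShift q w k k) (weightedShift q w l l) := by
  have hcomm : revGen q w k k * revGen q w l l = revGen q w l l * revGen q w k k := hw k l
  refine LinearMap.ext fun f => funext fun η => ?_
  have happly := congr_fun (congrArg (fun y => fockRep hq H 1 1 w y fun η => f η • v) hcomm) η
  simp only [map_mul, Module.End.mul_apply, fockRep_revGen_self_smul_vacuum, Pi.one_apply, one_mul]
    at happly
  exact smul_left_injective ℂ H.ne_zero happly

end FockFunctions

section Irreducibility

variable {n m e : ℕ} {q : ℂ} {V : Type*} [AddCommGroup V] [Module ℂ V]
  {Z : ℕ → ℕ → Module.End ℂ V} {v : V} {w : ModificationDatum n} {r c Λ : Fin n → ℂ}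

theorem IsFockRep.eq_top_of_scaledMatrix_stable (H : IsFockRep q e n Z v) (hr : ∀ k, r k ≠ 0)
    (hc : ∀ k, c k ≠ 0) {p : Submodule ℂ V} (hv : v ∈ p)
    (hp : ∀ i j, ∀ u ∈ p, scaledMatrix Z r c i j u ∈ p) : p = ⊤ :=
  H.cyclic p hv fun i hi j hj u hu =>
    (p.smul_mem_iff (mul_ne_zero (hr ⟨i, hi⟩) (hc (Fin.rev ⟨j, hj⟩)))).1 (hp ⟨i, hi⟩ ⟨j, hj⟩ u hu)

theorem IsFockRep.smul_vacuum_ne_zero (H : IsFockRep q e n Z v) {f : WeightLattice n → ℂ}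
    (hf : f ≠ 0) : (fun η => f η • v) ≠ 0 := by
  obtain ⟨η, hη⟩ := Function.ne_iff.1 hf
  exact fun h0 => smul_ne_zero hη H.ne_zero (congr_fun h0 η)

variable {hq0 : q ≠ 0} {H : IsFockRep q e n Z v} {u : WeightLattice n → V}

theorem IsHighestWeightVector.finrank_le_finrank_map_lift
    (h : IsHighestWeightVector m Λ (fockRep hq0 H r c w) u) (hr : ∀ k, r k ≠ 0)
    (hc : ∀ k, c k ≠ 0) {T : Submodule ℂ (RestrictedVerma m q w Λ)}
    [FiniteDimensional ℂ (T.map h.lift)] (hT : ∀ i j, ∀ x ∈ T, revGen q w i j • x ∈ T)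
    {g : WeightLattice n → ℂ} (hg : g ≠ 0) (hgT : (fun η => g η • v) ∈ T.map h.lift) :
    Module.finrank ℂ V ≤ Module.finrank ℂ (T.map h.lift) := by
  refine finrank_le_finrank_of_modRep_stable (w := w) hq0 (H.rel.scaledMatrix r c)
    (fun p hv hp => H.eq_top_of_scaledMatrix_stable hr hc hv hp) hg _ hgT ?_
  rintro i j _ ⟨x, hx, rfl⟩
  exact ⟨_, hT i j x hx, h.lift_smul _ x⟩

theorem IsHighestWeightVector.lift_injective {f : WeightLattice n → ℂ}
    (h : IsHighestWeightVector m Λ (fockRep hq0 H r c w) fun η => f η • v) (hr : ∀ k, r k ≠ 0)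
    (hc : ∀ k, c k ≠ 0) (hf : f ≠ 0) [FiniteDimensional ℂ (RestrictedVerma m q w Λ)]
    (hrank : Module.finrank ℂ (RestrictedVerma m q w Λ) ≤ Module.finrank ℂ V) :
    Function.Injective h.lift := by
  have hle : Module.finrank ℂ V ≤ Module.finrank ℂ (Submodule.map h.lift ⊤) := by
    exact h.finrank_le_finrank_map_lift hr hc (fun _ _ _ _ => Submodule.mem_top) hf
      ⟨_, Submodule.mem_top, h.lift_vermaVector⟩
  rw [Submodule.map_top] at hle
  have hsum := h.lift.finrank_range_add_finrank_ker
  exact LinearMap.ker_eq_bot.1 (Submodule.finrank_eq_zero.1 (by omega))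

theorem exists_mem_revGen_lower_smul_eq_zero (hr : 0 < reducedOrder m) (hq0 : q ≠ 0)
    (hqr : (q ^ 2) ^ reducedOrder m = 1) (hq : q ^ 2 ≠ 1)
    {T : Submodule ℂ (RestrictedVerma m q w Λ)} (hT : ∀ i j, ∀ x ∈ T, revGen q w i j • x ∈ T)
    (hne : T ≠ ⊥) : ∃ x ∈ T, x ≠ 0 ∧ ∀ i j, j < i → revGen q w i j • x = 0 :=
  (straightening_vermaRep (m := m) (w := w) (Λ := Λ) hq0).exists_lower_apply_eq_zero
    (fun _ _ hji => ⟨_, vermaRep_revGen_pow_eq_zero hr hq0 hqr hq hji.ne'⟩)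
    (fun i j _ => hT i j) hne

theorem IsHighestWeightVector.exists_lift_eq_smul_vacuum
    (h : IsHighestWeightVector m Λ (fockRep hq0 H r c w) u) (hr : ∀ k, r k ≠ 0)
    (hc : ∀ k, c k ≠ 0) (hinj : Function.Injective h.lift) {x : RestrictedVerma m q w Λ}
    (hx0 : x ≠ 0) (hx : ∀ i j, j < i → revGen q w i j • x = 0) :
    ∃ g : WeightLattice n → ℂ, g ≠ 0 ∧ h.lift x = fun η => g η • v := by
  obtain ⟨g, hg⟩ := exists_eq_smul_vacuum hq0 H hr hc (x := h.lift x) fun i j hji => by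
    rw [← h.lift_smul, hx i j hji, map_zero]
  refine ⟨g, ?_, hg⟩
  rintro rfl
  refine hx0 ((map_eq_zero_iff h.lift hinj).1 ?_)
  rw [hg]
  exact funext fun _ => zero_smul ℂ v

theorem IsHighestWeightVector.eq_top_of_stable
    (h : IsHighestWeightVector m Λ (fockRep hq0 H r c w) u) (hr : ∀ k, r k ≠ 0)
    (hc : ∀ k, c k ≠ 0) (hinj : Function.Injective h.lift)
    [FiniteDimensional ℂ (RestrictedVerma m q w Λ)]
    (hrank : Module.finrank ℂ (RestrictedVerma m q w Λ) ≤ Module.finrank ℂ V)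
    {T : Submodule ℂ (RestrictedVerma m q w Λ)} (hT : ∀ i j, ∀ x ∈ T, revGen q w i j • x ∈ T)
    {x : RestrictedVerma m q w Λ} (hxT : x ∈ T) (hx0 : x ≠ 0)
    (hx : ∀ i j, j < i → revGen q w i j • x = 0) : T = ⊤ := by
  obtain ⟨g, hg0, hg⟩ := h.exists_lift_eq_smul_vacuum hr hc hinj hx0 hx
  have hle := h.finrank_le_finrank_map_lift hr hc hT hg0 (hg ▸ Submodule.mem_map_of_mem hxT)
  exact Submodule.eq_top_of_finrank_eq (le_antisymm T.finrank_le
    (hrank.trans (hle.trans (Submodule.finrank_map_le h.lift T))))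

variable {f : WeightLattice n → ℂ} {s : Fin n → ℂ}

theorem isSimpleModule_restrictedVerma (hm : reducedOrder m = e + 1) (hq0 : q ≠ 0)
    (hqr : (q ^ 2) ^ reducedOrder m = 1) (hq : q ^ 2 ≠ 1) (H : IsFockRep q e n Z v) (hf : f ≠ 0)
    (hs : ∀ k, s k ≠ 0) (hfs : ∀ k, weightedShift q w k k f = s k • f) (hΛ : ∀ k, Λ k ≠ 0) :
    IsSimpleModule (modifiedAlgebra q w) (RestrictedVerma m q w Λ) := by
  have hr : ∀ k, Λ k / s k ≠ 0 := fun k => div_ne_zero (hΛ k) (hs k)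
  have hc : ∀ k : Fin n, (1 : Fin n → ℂ) k ≠ 0 := fun _ => one_ne_zero
  have h := isHighestWeightVector_smul_vacuum hq0 H hm hfs (r := fun k => Λ k / s k) (c := 1)
    fun k => by rw [Pi.one_apply, mul_one, div_mul_cancel₀ _ (hs k)]
  have hr0 : 0 < reducedOrder m := hm ▸ e.succ_pos
  obtain ⟨_, hrank⟩ := finrank_restrictedVerma_le (w := w) (Λ := Λ) hr0 hq0 hqr hq
  rw [hm, ← H.finrank] at hrank
  have hinj := h.lift_injective hr hc hf hrank
  have : Nontrivial (RestrictedVerma m q w Λ) :=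
    ⟨_, 0, h.vermaVector_ne_zero (H.smul_vacuum_ne_zero hf)⟩
  rw [isSimpleModule_iff]
  refine ⟨fun J => or_iff_not_imp_left.2 fun hJ => ?_⟩
  have hJstable : ∀ i j, ∀ x ∈ J.restrictScalars ℂ, revGen q w i j • x ∈ J.restrictScalars ℂ :=
    fun i j x hx => J.smul_mem _ hx
  obtain ⟨x, hxJ, hx0, hx⟩ := exists_mem_revGen_lower_smul_eq_zero hr0 hq0 hqr hq hJstable
    (mt (Submodule.restrictScalars_eq_bot_iff _ _ _).1 hJ)
  exact (Submodule.restrictScalars_eq_top_iff ℂ _ _).1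
    (h.eq_top_of_stable hr hc hinj hrank hJstable hxJ hx0 hx)

theorem IsHighestWeightVector.superdiag_smul_vermaVector_ne_zero
    (h : IsHighestWeightVector m Λ (fockRep hq0 H r c w) fun η => f η • v) (hf : f ≠ 0)
    (hq : q ^ 2 ≠ 1) {a b : Fin n} (hab : (b : ℕ) = a + 1) (hrc : r a * c b ≠ 0) :
    revGen q w a b • vermaVector m q w Λ ≠ 0 := by
  obtain ⟨η, hη⟩ := Function.ne_iff.1 (weightedShift_ne_zero (w := w) hq0 a b hf)
  intro h0
  have hlift := h.lift_smul_vermaVector (revGen q w a b)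
  rw [h0, map_zero, fockRep_revGen_smul] at hlift
  exact smul_ne_zero (mul_ne_zero hrc hη)
    (H.superdiag_ne_zero hq0 hq (by rw [Fin.val_rev]; omega)) (congr_fun hlift η).symm

theorem not_isSimpleModule_of_superdiag_ne_zero (hr : 0 < reducedOrder m) (hq0 : q ≠ 0)
    (hqr : (q ^ 2) ^ reducedOrder m = 1) (hq : q ^ 2 ≠ 1) {a b : Fin n} (hab : (b : ℕ) = a + 1)
    (hΛ : Λ a * Λ b = 0) (hne : revGen q w a b • vermaVector m q w Λ ≠ 0) :
    ¬ IsSimpleModule (modifiedAlgebra q w) (RestrictedVerma m q w Λ) := by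
  intro hsimple
  have hX := straightening_vermaRep (m := m) (w := w) (Λ := Λ) hq0
  have hvec := isHighestWeightVector_vermaVector (m := m) (q := q) (w := w) (Λ := Λ)
  have := IsSimpleModule.nontrivial (modifiedAlgebra q w) (RestrictedVerma m q w Λ)
  obtain ⟨φ, hφ, hφX⟩ := hX.exists_dual_comp_upper_eq_zero fun _ _ hij =>
    ⟨_, vermaRep_revGen_pow_eq_zero hr hq0 hqr hq hij.ne⟩
  have hker : Straightening.upperClosure (fun i j => vermaRep m q w Λ (revGen q w i j))
      (revGen q w a b • vermaVector m q w Λ) n ≤ φ.ker :=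
    Straightening.upperClosure_le le_rfl (hφX a b (by omega) _) hφX
  have hstable := hX.apply_mem_upperClosure (s := revGen q w a b • vermaVector m q w Λ)
    (fun _ _ hji => hX.lower_superdiag_apply_eq_zero hvec.lower hvec.diag hab hΛ hji)
    (fun i => hX.exists_diag_superdiag_apply hvec.diag hab i)
  refine hφ (LinearMap.ker_eq_top.1 (eq_top_iff.2 fun x _ => hker ?_))
  obtain ⟨y, rfl⟩ := IsSimpleModule.toSpanSingleton_surjective (modifiedAlgebra q w) hne x
  exact apply_mem_of_forall_revGen (vermaRep m q w Λ) (fun i j u hu => hstable i j hu) y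
    (Straightening.mem_upperClosure le_rfl)

theorem not_isSimpleModule_restrictedVerma (hn : 2 ≤ n) (hm : reducedOrder m = e + 1)
    (hq0 : q ≠ 0) (hqr : (q ^ 2) ^ reducedOrder m = 1) (hq : q ^ 2 ≠ 1) (H : IsFockRep q e n Z v)
    (hf : f ≠ 0) (hs : ∀ k, s k ≠ 0) (hfs : ∀ k, weightedShift q w k k f = s k • f) {k : Fin n}
    (hk : Λ k = 0) : ¬ IsSimpleModule (modifiedAlgebra q w) (RestrictedVerma m q w Λ) := by
  obtain ⟨a, b, hab, hΛ⟩ : ∃ a b : Fin n, (b : ℕ) = a + 1 ∧ Λ a * Λ b = 0 := by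
    by_cases hkn : (k : ℕ) + 1 < n
    · exact ⟨k, ⟨k + 1, hkn⟩, rfl, by rw [hk, zero_mul]⟩
    · exact ⟨⟨k - 1, by omega⟩, k, by dsimp only; omega, by rw [hk, mul_zero]⟩
  have hba : b ≠ a := fun h => by omega
  have h := isHighestWeightVector_smul_vacuum hq0 H hm hfs (Λ := Λ)
    (r := fun i => if i = a then 1 else Λ i / s i) (c := fun i => if i = a then Λ i / s i else 1)
    fun k => by split_ifs <;> simp [div_mul_cancel₀ _ (hs k)]
  exact not_isSimpleModule_of_superdiag_ne_zero (hm ▸ e.succ_pos) hq0 hqr hq hab hΛ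
    (h.superdiag_smul_vermaVector_ne_zero hf hq hab (by simp [hba]))

end Irreducibility

theorem one_lt_reducedOrder {m : ℕ} (hm : 2 < m) : 1 < reducedOrder m := by
  unfold reducedOrder
  split_ifs with h
  · obtain ⟨k, rfl⟩ := h
    omega
  · omega

theorem dvd_two_mul_iff_reducedOrder_dvd (m p : ℕ) : m ∣ 2 * p ↔ reducedOrder m ∣ p := by
  unfold reducedOrder
  split_ifs with h
  · obtain ⟨k, rfl⟩ := h
    rw [← two_mul, Nat.mul_div_cancel_left k two_pos, Nat.mul_dvd_mul_iff_left two_pos]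
  · exact (Nat.coprime_two_right.2 (Nat.not_even_iff_odd.1 h)).dvd_mul_left

theorem mainTheorem5 (n m : ℕ) (hn : 2 ≤ n) (hm : 2 < m) (q : ℂ) (hq : IsPrimitiveRoot q m)
    (w : ModificationDatum n) (hw : AntidiagonalCommutes q w) (Λ : Fin n → ℂ) :
    IsSimpleModule (modifiedAlgebra q w) (RestrictedVerma m q w Λ) ↔ ∀ i, Λ i ≠ 0 := by
  have hq0 : q ≠ 0 := hq.ne_zero (by omega)
  have hpow : ∀ p, q ^ (2 * p) = 1 ↔ reducedOrder m ∣ p := fun p => by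
    rw [hq.pow_eq_one_iff_dvd, dvd_two_mul_iff_reducedOrder_dvd]
  have hlt : ∀ p, 0 < p → p < reducedOrder m → q ^ (2 * p) ≠ 1 := fun p hp hpm h =>
    absurd (Nat.le_of_dvd hp ((hpow p).1 h)) (not_le.2 hpm)
  have hqr : (q ^ 2) ^ reducedOrder m = 1 := by rw [← pow_mul, hpow]
  have hq2 : q ^ 2 ≠ 1 := hlt 1 one_pos (one_lt_reducedOrder hm)
  obtain ⟨e, he⟩ := Nat.exists_eq_add_one.2 (zero_lt_one.trans (one_lt_reducedOrder hm))
  obtain ⟨V, _, _, Z, v, H⟩ := exists_isFockRep hq0 ((hpow _).2 he.dvd) (he ▸ hlt) n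
  obtain ⟨f, hf, s, hs, hfs⟩ := exists_weightedShift_eigenfunction (by omega) hq.pow_eq_one
    (commute_weightedShift hq0 H hw)
  refine ⟨fun hsimple i hi => ?_, fun hΛ => ?_⟩
  · exact not_isSimpleModule_restrictedVerma hn he hq0 hqr hq2 H hf hs hfs hi hsimple
  · exact isSimpleModule_restrictedVerma he hq0 hqr hq2 H hf hs hfs hΛ
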